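/- For a regular cardinal $\chi$ let $\mathcal H_\chi$ be the collection of all sets whose transitive closure has size $<\chi$, and let $\mathcal M^\sqsubset_\chi$ be the set of all $M\prec(\mathcal H_\chi,\in)$ with $|M|=\aleph_1$ for which there is a well-ordering $\sqsubset$ of $M$ of order type $\omega_1$ such that, for every $a\in M$, ${\sqsubset}\cap(M_{\sqsubset a})^2\in M$, where $M_{\sqsubset a}=\{x\in M: x\sqsubset a\}$. For partial orders $Q\subseteq P$ (with the order of $P$ restricted to $Q$), write $Q\le_\sigma P$ if for every $p\in P$ the set $\{q\in Q:q\le p\}$ has a countable cofinal subset and $\{q\in Q:q\ge p\}$ has a countable coinitial subset. Let $\operatorname{SEP}^{+-}(P)$ be the statement that there are a regular cardinal $\chi$ with $P\in\mathcal H_\chi$ and an $M\in\mathcal M^\sqsubset_\chi$ such that $P\cap M\le_\sigma P$. Order $\mathcal P(\omega)$ by inclusion. A maximal almost disjoint (MAD) family is an infinite family of infinite subsets of $\omega$, any two distinct members of which have finite intersection, that is maximal under inclusion among such families; $\mathfrak a$ is the smallest size of a MAD family. **Theorem.** $\operatorname{SEP}^{+-}(\mathcal P(\omega))$ implies $\mathfrak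 a=\aleph_1$. Moreover, whenever $\chi$ is a regular cardinal with $\mathcal P(\omega)\in\mathcal H_\chi$ and $M\in\mathcal M^\sqsubset_\chi$ satisfies $\mathcal P(\omega)\cap M\le_\sigma\mathcal P(\omega)$, there is a MAD family of size $\aleph_1$ all of whose members belong to $M$. -/

import Mathlib

open Cardinal

universe u

namespace SepVariant

/-! ### The structures `(N, ∈)` and elementary submodels -/

/-- The only non-logical symbol of the language of set theory: a binary relation symbol. -/
inductive MemRel : ℕ → Type
  | mem : MemRel 2

/-- The first-order language of set theory. -/
def memLang : FirstOrder.Language.{0, 0} := ⟨fun _ => Empty, MemRel⟩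

/-- Every collection `N` of sets is regarded as the structure `(N, ∈)`. -/
instance memStructure (N : Set ZFSet.{u}) : memLang.Structure N where
  funMap := fun f => Empty.elim f
  RelMap := fun r =>
    match r with
    | MemRel.mem => fun v => (v 0 : ZFSet.{u}) ∈ (v 1 : ZFSet.{u})

/-- `M ≺ N`: `M` is a subset of `N` and the inclusion map is elementary for the language
of set theory. -/
def IsElementarySubmodel (M N : Set ZFSet.{u}) : Prop :=
  ∃ f : FirstOrder.Language.ElementaryEmbedding memLang M N,
    ∀ x : M, ((f x : N) : ZFSet.{u}) = (x : ZFSet.{u})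

/-- The transitive closure of the set `x`. -/
def trcl (x : ZFSet.{u}) : Set ZFSet.{u} :=
  {y | Relation.TransGen (fun a b : ZFSet.{u} => a ∈ b) y x}

/-- `H_χ`: the collection of the sets whose transitive closure has fewer than `χ` elements. -/
def hSet (χ : Cardinal.{u}) : Set ZFSet.{u} :=
  {x | #(trcl x) < Cardinal.lift.{u + 1} χ}

/-- `M ∈ 𝓜^⊏_χ`: `M ≺ H_χ`, `M` has size `ℵ₁`, and there is a well-ordering `⊏` of `M` of order
type `ω₁` such that for every `a ∈ M`, the restriction of `⊏` to `{x ∈ M | x ⊏ a}`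
(a set `s` of Kuratowski pairs) is an element of `M`. -/
def IsApproachableModel (χ : Cardinal.{u}) (M : Set ZFSet.{u}) : Prop :=
  IsElementarySubmodel M (hSet χ) ∧ #M = ℵ₁ ∧
    ∃ (r : M → M → Prop) (_ : IsWellOrder M r),
      Ordinal.type r = Ordinal.omega 1 ∧
      ∀ a : M, ∃ s ∈ M, ∀ z : ZFSet.{u},
        z ∈ s ↔ ∃ x y : M, r x a ∧ r y a ∧ r x y ∧ z = ZFSet.pair x y

/-! ### `σ`-suborders and the principle -/

/-- `Q ≤_σ P` for `Q ⊆ P`, where `P` is ordered by `le`: for all `p ∈ P`, the set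
`{q ∈ Q | q ≤ p}` has a countable cofinal subset and `{q ∈ Q | p ≤ q}` has a countable coinitial
subset. -/
def SigmaSuborder {α : Type*} (le : α → α → Prop) (Q P : Set α) : Prop :=
  Q ⊆ P ∧ ∀ p ∈ P,
    (∃ C : Set α, C.Countable ∧ C ⊆ {q ∈ Q | le q p} ∧
      ∀ q ∈ Q, le q p → ∃ c ∈ C, le q c) ∧
    (∃ C : Set α, C.Countable ∧ C ⊆ {q ∈ Q | le p q} ∧
      ∀ q ∈ Q, le p q → ∃ c ∈ C, le c q)

/-- `SEP^{+-}` of the partial order with underlying set `P` and order `le`: for some regular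
cardinal `χ`, large enough for `P` to belong to `H_χ`, there is `M ∈ 𝓜^⊏_χ` with
`P ∩ M ≤_σ P`. -/
def SEPpm (P : ZFSet.{u}) (le : ZFSet.{u} → ZFSet.{u} → Prop) : Prop :=
  ∃ χ : Cardinal.{u}, χ.IsRegular ∧ P ∈ hSet χ ∧
    ∃ M : Set ZFSet.{u}, IsApproachableModel χ M ∧
      SigmaSuborder le ((P : Set ZFSet.{u}) ∩ M) (P : Set ZFSet.{u})

/-! ### Subsets of `ω` as sets, and almost disjoint families -/

/-- The von Neumann natural number `n`. -/
def natZF : ℕ → ZFSet.{u}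
  | 0 => ∅
  | n + 1 => insert (natZF n) (natZF n)

/-- The subset of the ordinal `ω` that corresponds to the set `a` of natural numbers. -/
def subsetZF (a : Set ℕ) : ZFSet.{u} :=
  ZFSet.sep (fun z => ∃ n ∈ a, z = natZF n) ZFSet.omega

/-- An infinite family of infinite subsets of `ω` any two distinct members of which have finite
intersection. -/
def IsAlmostDisjointFamily (A : Set (Set ℕ)) : Prop :=
  A.Infinite ∧ (∀ a ∈ A, a.Infinite) ∧ A.Pairwise fun a b => (a ∩ b).Finite

/-- A maximal almost disjoint (MAD) family: an (infinite) almost disjoint family that is not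
properly contained in another one. -/
def IsMADFamily (A : Set (Set ℕ)) : Prop :=
  Maximal IsAlmostDisjointFamily A

/-- The cardinal invariant `𝔞`: the smallest size of a maximal almost disjoint family. -/
noncomputable def almostDisjointnessNumber : Cardinal.{0} :=
  sInf {κ | ∃ A : Set (Set ℕ), IsMADFamily A ∧ #A = κ}

end SepVariant

/-! Sets `a x` are built by recursion along ⊏: `a x` is almost disjoint from the different sets
chosen before it, and it has infinite intersection with every earlier d ⊆ ω in M that contains an
infinite set almost disjoint from those chosen before. Suppose an infinite X is almost disjoint from
every `a x`. For each n, take a countable coinitial family among the supersets of X \ [0,n] in M,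
and let x lie above all members of these families. For some n, X \ [0,n] ⊆ ω \ `a x` ∈ M, so some d
in the n-th family satisfies X \ [0,n] ⊆ d ⊆ ω \ `a x`. But X \ [0,n] witnesses that `a x` must meet
d infinitely often, a contradiction.

The recursion has to produce elements of M, while only the initial segments of ⊏ are known to lie in
M. So `a x` is made to depend only on `E x`, the restriction of ⊏ to the subsets of ω below x, which
is a countable relation in M. A single function G, a selector, performs the recursion for all such
relations at once. It exists in H_χ because there are at most 𝔠 < χ countable relations on 𝒫(ω)
(`exists_isSelector`). Being a selector is first-order over H_χ (`DefinableIn.isSelector`), so M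
contains some selector, and its value at `E x` ∈ M lies in M.

The recursion step is the diagonalization `exists_almostDisjoint_meeting`. Keeping all values sparse
ensures that finitely many of them never cover ω up to a finite set. The same diagonalization shows
that no MAD family is countable, which turns size ℵ₁ into 𝔞 = ℵ₁. -/

namespace SepVariant

/-! ### First-order definability over `(N, ∈)` and elementarity -/

open FirstOrder.Language in
/-- The relation `P` between sets, restricted to `N`, is defined in `(N, ∈)` by a first-order
formula without parameters. -/
def DefinableIn (N : Set ZFSet.{u}) {α : Type} (P : (α → ZFSet.{u}) → Prop) : Prop :=
  ∃ φ : memLang.Formula α, ∀ v : α → N, φ.Realize v ↔ P (fun a => v a)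

namespace DefinableIn

variable {N : Set ZFSet.{u}} {α : Type}

/-- Equivalence is required only on tuples from N, so quantifiers over the universe may be replaced
by quantifiers over N whenever the notion is absolute. -/
theorem congr {P Q : (α → ZFSet.{u}) → Prop} (h : DefinableIn N P)
    (hPQ : ∀ v : α → ZFSet.{u}, (∀ a, v a ∈ N) → (Q v ↔ P v)) : DefinableIn N Q := by
  obtain ⟨φ, hφ⟩ := h
  exact ⟨φ, fun v => (hφ v).trans (hPQ _ fun a => (v a).2).symm⟩

theorem mem (i j : α) : DefinableIn N (fun v => v i ∈ v j) :=
  ⟨FirstOrder.Language.Relations.formula₂ (L := memLang) MemRel.mem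
    (FirstOrder.Language.Term.var i) (FirstOrder.Language.Term.var j), fun _ =>
    FirstOrder.Language.Formula.realize_rel₂.trans Iff.rfl⟩

theorem eq (i j : α) : DefinableIn N (fun v => v i = v j) :=
  ⟨FirstOrder.Language.Term.equal
    (FirstOrder.Language.Term.var i) (FirstOrder.Language.Term.var j), fun v => by
    rw [FirstOrder.Language.Formula.realize_equal]; exact Subtype.ext_iff⟩

theorem not {P : (α → ZFSet.{u}) → Prop} (h : DefinableIn N P) :
    DefinableIn N (fun v => ¬ P v) := by
  obtain ⟨φ, hφ⟩ := h
  exact ⟨φ.not, fun v => by rw [FirstOrder.Language.Formula.realize_not, hφ]⟩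

theorem and {P Q : (α → ZFSet.{u}) → Prop} (hP : DefinableIn N P) (hQ : DefinableIn N Q) :
    DefinableIn N (fun v => P v ∧ Q v) := by
  obtain ⟨φ, hφ⟩ := hP
  obtain ⟨ψ, hψ⟩ := hQ
  exact ⟨φ ⊓ ψ, fun v => by rw [FirstOrder.Language.Formula.realize_inf, hφ, hψ]⟩

theorem or {P Q : (α → ZFSet.{u}) → Prop} (hP : DefinableIn N P) (hQ : DefinableIn N Q) :
    DefinableIn N (fun v => P v ∨ Q v) :=
  (hP.not.and hQ.not).not.congr fun v _ => by tauto

theorem imp {P Q : (α → ZFSet.{u}) → Prop} (hP : DefinableIn N P) (hQ : DefinableIn N Q) :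
    DefinableIn N (fun v => P v → Q v) :=
  (hP.and hQ.not).not.congr fun v _ => by tauto

theorem ex {P : ZFSet.{u} → (α → ZFSet.{u}) → Prop}
    (h : DefinableIn N (fun w : α ⊕ Unit → ZFSet.{u} => P (w (Sum.inr ())) fun a => w (Sum.inl a))) :
    DefinableIn N (fun v => ∃ x ∈ N, P x v) := by
  obtain ⟨φ, hφ⟩ := h
  refine ⟨φ.iExs Unit, fun v => ?_⟩
  rw [FirstOrder.Language.Formula.realize_iExs]
  constructor
  · rintro ⟨i, hi⟩
    exact ⟨i (), (i ()).2, (hφ _).1 hi⟩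
  · rintro ⟨x, hx, hP⟩
    exact ⟨fun _ => ⟨x, hx⟩, (hφ _).2 hP⟩

theorem all {P : ZFSet.{u} → (α → ZFSet.{u}) → Prop}
    (h : DefinableIn N (fun w : α ⊕ Unit → ZFSet.{u} => P (w (Sum.inr ())) fun a => w (Sum.inl a))) :
    DefinableIn N (fun v => ∀ x ∈ N, P x v) :=
  (ex (P := fun x v => ¬ P x v) h.not).not.congr fun _ _ => by push Not; rfl

theorem exMem (hN : ∀ x ∈ N, ∀ y ∈ x, y ∈ N) {P : ZFSet.{u} → (α → ZFSet.{u}) → Prop} (i : α)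
    (h : DefinableIn N (fun w : α ⊕ Unit → ZFSet.{u} => P (w (Sum.inr ())) fun a => w (Sum.inl a))) :
    DefinableIn N (fun v => ∃ x ∈ v i, P x v) :=
  (ex (P := fun x v => x ∈ v i ∧ P x v) ((mem _ _).and h)).congr fun _ hv =>
    ⟨fun ⟨x, hx, hP⟩ => ⟨x, hN _ (hv i) _ hx, hx, hP⟩, fun ⟨x, _, hx, hP⟩ => ⟨x, hx, hP⟩⟩

theorem allMem (hN : ∀ x ∈ N, ∀ y ∈ x, y ∈ N) {P : ZFSet.{u} → (α → ZFSet.{u}) → Prop} (i : α)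
    (h : DefinableIn N (fun w : α ⊕ Unit → ZFSet.{u} => P (w (Sum.inr ())) fun a => w (Sum.inl a))) :
    DefinableIn N (fun v => ∀ x ∈ v i, P x v) :=
  (exMem hN (P := fun x v => ¬ P x v) i h.not).not.congr fun _ _ => by push Not; rfl

end DefinableIn

/-- A definable relation with parameters in an elementary submodel that is satisfied by some
element is satisfied by some element of the submodel. -/
theorem IsElementarySubmodel.exists_mem {M N : Set ZFSet.{u}} (hM : IsElementarySubmodel M N)
    {α : Type} {P : ZFSet.{u} → (α → ZFSet.{u}) → Prop}
    (h : DefinableIn N (fun w : α ⊕ Unit → ZFSet.{u} => P (w (Sum.inr ())) fun a => w (Sum.inl a)))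
    (v : α → ZFSet.{u}) (hv : ∀ a, v a ∈ M) (hex : ∃ x ∈ N, P x v) : ∃ x ∈ M, P x v := by
  obtain ⟨f, hf⟩ := hM
  obtain ⟨φ, hφ⟩ := h
  let v' : α → M := fun a => ⟨v a, hv a⟩
  obtain ⟨x, hx, hP⟩ := hex
  have h1 : (φ.iExs Unit).Realize (f ∘ v') := by
    rw [FirstOrder.Language.Formula.realize_iExs]
    refine ⟨fun _ => ⟨x, hx⟩, (hφ _).2 ?_⟩
    simpa [hf, v'] using hP
  rw [f.map_formula, FirstOrder.Language.Formula.realize_iExs] at h1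
  obtain ⟨i, hi⟩ := h1
  refine ⟨i (), (i ()).2, ?_⟩
  rw [← f.map_formula, hφ] at hi
  simpa [hf, v'] using hi

theorem IsElementarySubmodel.subset {M N : Set ZFSet.{u}} (hM : IsElementarySubmodel M N) :
    M ⊆ N := by
  obtain ⟨f, hf⟩ := hM
  intro x hx
  have := (f ⟨x, hx⟩).2
  rwa [hf] at this

/-! ### The sets `H_χ` -/

theorem trcl_subset_of_mem {x y : ZFSet.{u}} (h : y ∈ x) : trcl y ⊆ trcl x :=
  fun _ hz => Relation.TransGen.tail hz h

theorem trcl_mono {x y : ZFSet.{u}} (h : y ⊆ x) : trcl y ⊆ trcl x := by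
  intro z hz
  rcases Relation.TransGen.tail'_iff.1 hz with ⟨w, hzw, hwy⟩
  exact Relation.TransGen.tail'_iff.2 ⟨w, hzw, h hwy⟩

theorem trcl_eq (x : ZFSet.{u}) : trcl x = (x : Set ZFSet.{u}) ∪ ⋃ y ∈ (x : Set ZFSet.{u}), trcl y := by
  ext z
  simp only [Set.mem_union, Set.mem_iUnion, exists_prop, SetLike.mem_coe]
  constructor
  · intro hz
    rcases Relation.TransGen.tail'_iff.1 hz with ⟨w, hzw, hwy⟩
    rcases Relation.reflTransGen_iff_eq_or_transGen.1 hzw with h | h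
    · subst h; exact Or.inl hwy
    · exact Or.inr ⟨w, hwy, h⟩
  · rintro (h | ⟨y, hy, h⟩)
    · exact Relation.TransGen.single h
    · exact trcl_subset_of_mem hy h

section hSet

variable {χ : Cardinal.{u}}

theorem hSet_trans : ∀ x ∈ hSet χ, ∀ y ∈ x, y ∈ hSet χ := fun _ hx _ hy =>
  (Cardinal.mk_le_mk_of_subset (trcl_subset_of_mem hy)).trans_lt hx

theorem hSet_of_subset {x y : ZFSet.{u}} (hy : y ∈ hSet χ) (h : x ⊆ y) : x ∈ hSet χ :=
  (Cardinal.mk_le_mk_of_subset (trcl_mono h)).trans_lt hy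

theorem mk_lt_of_mem_hSet {x : ZFSet.{u}} (hx : x ∈ hSet χ) :
    #(x : Set ZFSet.{u}) < Cardinal.lift.{u + 1} χ := by
  refine (Cardinal.mk_le_mk_of_subset ?_).trans_lt hx
  rw [trcl_eq]
  exact Set.subset_union_left

/-- Regularity of χ: the transitive closure is x together with fewer than χ sets, each of size less
than χ. -/
theorem mem_hSet_of_forall (hχ : χ.IsRegular) {x : ZFSet.{u}} (h : ∀ y ∈ x, y ∈ hSet χ)
    (hc : #(x : Set ZFSet.{u}) < Cardinal.lift.{u + 1} χ) : x ∈ hSet χ := by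
  have hr : (Cardinal.lift.{u + 1} χ).IsRegular := hχ.lift
  change #(trcl x) < _
  rw [trcl_eq]
  refine (Cardinal.mk_union_le _ _).trans_lt (Cardinal.add_lt_of_lt hr.aleph0_le hc ?_)
  exact (Cardinal.card_biUnion_lt_iff_forall_of_isRegular hr hc).2 fun y hy => h y hy

theorem range_mem_hSet (hχ : χ.IsRegular) {β : Type} (f : β → ZFSet.{u})
    (hf : ∀ b, f b ∈ hSet χ) (hβ : Cardinal.lift.{u} #β < χ) : ZFSet.range f ∈ hSet χ := by
  refine mem_hSet_of_forall hχ ?_ ?_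
  · intro y hy
    obtain ⟨b, rfl⟩ := ZFSet.mem_range.1 hy
    exact hf b
  · rw [ZFSet.coe_range]
    have h1 := Cardinal.mk_range_le_lift (f := f)
    have h2 := Cardinal.lift_lt.{u, u + 1}.2 hβ
    simp only [Cardinal.lift_lift, Cardinal.lift_id'] at h1 h2 ⊢
    refine lt_of_le_of_lt ?_ h2
    simpa using h1

theorem pair_set_mem_hSet (hχ : χ.IsRegular) {x y : ZFSet.{u}} (hx : x ∈ hSet χ) (hy : y ∈ hSet χ) :
    ({x, y} : ZFSet.{u}) ∈ hSet χ := by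
  refine mem_hSet_of_forall hχ ?_ ?_
  · intro z hz
    rcases ZFSet.mem_pair.1 hz with rfl | rfl <;> assumption
  · rw [ZFSet.coe_insert, ZFSet.coe_singleton]
    exact (Cardinal.lt_aleph0_iff_set_finite.2 (Set.toFinite _)).trans_le hχ.lift.aleph0_le

theorem pair_mem_hSet (hχ : χ.IsRegular) {x y : ZFSet.{u}} (hx : x ∈ hSet χ) (hy : y ∈ hSet χ) :
    ZFSet.pair x y ∈ hSet χ := by
  refine pair_set_mem_hSet hχ ?_ (pair_set_mem_hSet hχ hx hy)
  rw [← ZFSet.pair_eq_singleton]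
  exact pair_set_mem_hSet hχ hx hx

end hSet

/-! ### Subsets of `ω` -/

theorem natZF_mem_omega (n : ℕ) : natZF.{u} n ∈ ZFSet.omega.{u} := by
  induction n with
  | zero => exact ZFSet.omega_zero
  | succ n ih => exact ZFSet.omega_succ ih

theorem natZF_eq_mk (n : ℕ) : natZF.{u} n = ZFSet.mk (PSet.ofNat n) := by
  induction n with
  | zero => rfl
  | succ n ih => rw [natZF, ih]; rfl

theorem mem_omega_iff {z : ZFSet.{u}} : z ∈ ZFSet.omega.{u} ↔ ∃ n, z = natZF n := by
  constructor
  · refine Quotient.inductionOn z fun x => ?_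
    rintro ⟨⟨n⟩, h⟩
    exact ⟨n, (ZFSet.sound h).trans (natZF_eq_mk n).symm⟩
  · rintro ⟨n, rfl⟩
    exact natZF_mem_omega n

theorem mem_natZF_iff {n : ℕ} {z : ZFSet.{u}} : z ∈ natZF.{u} n ↔ ∃ m < n, z = natZF m := by
  induction n with
  | zero => simp [natZF]
  | succ n ih =>
    rw [natZF, ZFSet.mem_insert_iff, ih]
    constructor
    · rintro (h | ⟨m, hm, h⟩)
      · exact ⟨n, by omega, h⟩
      · exact ⟨m, by omega, h⟩
    · rintro ⟨m, hm, h⟩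
      rcases Nat.lt_succ_iff_lt_or_eq.1 hm with h' | rfl
      · exact Or.inr ⟨m, h', h⟩
      · exact Or.inl h

theorem natZF_injective : Function.Injective natZF.{u} := by
  have key : ∀ m n, m < n → natZF.{u} m ≠ natZF n := fun m n h he =>
    ZFSet.mem_irrefl (natZF.{u} n) (mem_natZF_iff.2 ⟨m, h, he.symm⟩)
  intro m n h
  rcases lt_trichotomy m n with h' | h' | h'
  · exact absurd h (key _ _ h')
  · exact h'
  · exact absurd h.symm (key _ _ h')

theorem natZF_mem_natZF_iff {m n : ℕ} : natZF.{u} m ∈ natZF.{u} n ↔ m < n := by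
  rw [mem_natZF_iff]
  constructor
  · rintro ⟨k, hk, h⟩
    rwa [natZF_injective h]
  · exact fun h => ⟨m, h, rfl⟩

/-- The set of natural numbers that corresponds to the set `a`. -/
def natsOf (a : ZFSet.{u}) : Set ℕ := {n | natZF n ∈ a}

theorem mem_natsOf {a : ZFSet.{u}} {n : ℕ} : n ∈ natsOf a ↔ natZF n ∈ a := Iff.rfl

theorem mem_subsetZF {a : Set ℕ} {z : ZFSet.{u}} : z ∈ subsetZF.{u} a ↔ ∃ n ∈ a, z = natZF n := by
  rw [subsetZF, ZFSet.mem_sep]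
  exact ⟨fun h => h.2, fun h => ⟨mem_omega_iff.2 (h.imp fun _ h => h.2), h⟩⟩

theorem subsetZF_subset (a : Set ℕ) : subsetZF.{u} a ⊆ ZFSet.omega := ZFSet.sep_subset

theorem natsOf_subsetZF (a : Set ℕ) : natsOf (subsetZF.{u} a) = a := by
  ext n
  rw [mem_natsOf, mem_subsetZF]
  constructor
  · rintro ⟨m, hm, h⟩
    rwa [natZF_injective h]
  · exact fun h => ⟨n, h, rfl⟩

theorem subsetZF_natsOf {a : ZFSet.{u}} (ha : a ⊆ ZFSet.omega) : subsetZF (natsOf a) = a := by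
  ext z
  rw [mem_subsetZF]
  constructor
  · rintro ⟨n, hn, rfl⟩
    exact hn
  · intro hz
    obtain ⟨n, rfl⟩ := mem_omega_iff.1 (ha hz)
    exact ⟨n, hz, rfl⟩

theorem natsOf_mono {a b : ZFSet.{u}} (h : a ⊆ b) : natsOf a ⊆ natsOf b := fun _ hn => h hn

theorem finite_inter_iff_exists {a b : ZFSet.{u}} : (natsOf a ∩ natsOf b).Finite ↔
    ∃ n ∈ ZFSet.omega, ∀ k ∈ ZFSet.omega, k ∈ a → k ∈ b → k ∈ n := by
  rw [Set.finite_iff_bddAbove, bddAbove_def]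
  constructor
  · rintro ⟨n, hn⟩
    refine ⟨natZF (n + 1), natZF_mem_omega _, fun k hk ha hb => ?_⟩
    obtain ⟨m, rfl⟩ := mem_omega_iff.1 hk
    exact natZF_mem_natZF_iff.2 (Nat.lt_succ_of_le (hn m ⟨ha, hb⟩))
  · rintro ⟨n, hn, h⟩
    obtain ⟨m, rfl⟩ := mem_omega_iff.1 hn
    exact ⟨m, fun k hk => (natZF_mem_natZF_iff.1 (h _ (natZF_mem_omega k) hk.1 hk.2)).le⟩

/-- Closure under successor gives one inclusion; ∈-induction on elements that are empty or
successors gives the other. All quantifiers are bounded, and emptiness is written with `y ≠ y` so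
that the translation into a formula is direct. -/
theorem eq_omega_iff {t : ZFSet.{u}} : t = ZFSet.omega ↔
    (∃ x ∈ t, ∀ y ∈ x, y ≠ y) ∧ (∀ x ∈ t, ∃ y ∈ t, y = insert x x) ∧
      ∀ x ∈ t, (∀ y ∈ x, y ≠ y) ∨ ∃ y ∈ t, x = insert y y := by
  constructor
  · rintro rfl
    refine ⟨⟨∅, ZFSet.omega_zero, by simp⟩, fun x hx => ⟨_, ZFSet.omega_succ hx, rfl⟩, ?_⟩
    intro x hx
    obtain ⟨n, rfl⟩ := mem_omega_iff.1 hx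
    cases n with
    | zero => exact Or.inl (by simp [natZF])
    | succ n => exact Or.inr ⟨_, natZF_mem_omega n, rfl⟩
  · rintro ⟨⟨e, he, he'⟩, h2, h3⟩
    have he0 : e = ∅ := (ZFSet.eq_empty e).2 fun y hy => he' y hy rfl
    subst he0
    ext z
    rw [mem_omega_iff]
    constructor
    · induction z using ZFSet.inductionOn with
      | _ z ih =>
        intro hz
        rcases h3 z hz with h | ⟨y, hy, rfl⟩
        · exact ⟨0, (ZFSet.eq_empty z).2 fun y hy => h y hy rfl⟩
        · obtain ⟨n, rfl⟩ := ih y (ZFSet.mem_insert _ _) hy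
          exact ⟨n + 1, rfl⟩
    · rintro ⟨n, rfl⟩
      induction n with
      | zero => exact he
      | succ n ih =>
        obtain ⟨y, hy, rfl⟩ := h2 _ ih
        exact hy

/-! ### Definability of set-theoretic notions -/

namespace DefinableIn

variable {N : Set ZFSet.{u}} {α : Type}

theorem subset (hN : ∀ x ∈ N, ∀ y ∈ x, y ∈ N) (i j : α) : DefinableIn N (fun v => v i ⊆ v j) :=
  (allMem hN (P := fun x v => x ∈ v j) i (mem _ _)).congr fun _ _ => Iff.rfl

theorem eqPairSet (hN : ∀ x ∈ N, ∀ y ∈ x, y ∈ N) (i j k : α) :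
    DefinableIn N (fun v => v i = {v j, v k}) := by
  refine congr (P := fun v => v j ∈ v i ∧ v k ∈ v i ∧ ∀ x ∈ v i, x = v j ∨ x = v k) ?_ ?_
  · exact (mem _ _).and ((mem _ _).and (allMem hN i ((eq _ _).or (eq _ _))))
  · intro v _
    constructor
    · intro h
      rw [h]
      simp
    · rintro ⟨h1, h2, h3⟩
      ext z
      rw [ZFSet.mem_pair]
      exact ⟨h3 z, by rintro (rfl | rfl) <;> assumption⟩

theorem eqInsertSelf (hN : ∀ x ∈ N, ∀ y ∈ x, y ∈ N) (i j : α) :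
    DefinableIn N (fun v => v i = insert (v j) (v j)) := by
  refine congr (P := fun v => v j ∈ v i ∧ (∀ x ∈ v j, x ∈ v i) ∧
    ∀ x ∈ v i, x = v j ∨ x ∈ v j) ?_ ?_
  · exact (mem _ _).and ((allMem hN j (mem _ _)).and (allMem hN i ((eq _ _).or (mem _ _))))
  · intro v _
    constructor
    · intro h
      rw [h]
      simp +contextual
    · rintro ⟨h1, h2, h3⟩
      ext z
      rw [ZFSet.mem_insert_iff]
      exact ⟨h3 z, by rintro (rfl | h); exacts [h1, h2 _ h]⟩

theorem eqOmega (hN : ∀ x ∈ N, ∀ y ∈ x, y ∈ N) (i : α) :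
    DefinableIn N (fun v => v i = ZFSet.omega) := by
  refine congr (P := fun v => (∃ x ∈ v i, ∀ y ∈ x, ¬ y = y) ∧ (∀ x ∈ v i, ∃ y ∈ v i, y = insert x x) ∧
      ∀ x ∈ v i, (∀ y ∈ x, ¬ y = y) ∨ ∃ y ∈ v i, x = insert y y) ?_ fun v _ => eq_omega_iff
  refine and ?_ (and ?_ ?_)
  · exact exMem hN _ (allMem hN _ (not (eq _ _)))
  · exact allMem hN _ (exMem hN _ (eqInsertSelf hN _ _))
  · exact allMem hN _ (or (allMem hN _ (not (eq _ _))) (exMem hN _ (eqInsertSelf hN _ _)))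

theorem eqPair (hN : ∀ x ∈ N, ∀ y ∈ x, y ∈ N) (i j k : α) :
    DefinableIn N (fun v => v i = ZFSet.pair (v j) (v k)) := by
  refine congr (P := fun v => ∃ x ∈ v i, ∃ y ∈ v i, x = {v j, v j} ∧ y = {v j, v k} ∧
    v i = {x, y}) ?_ ?_
  · exact exMem hN _ (exMem hN _ ((eqPairSet hN _ _ _).and
      ((eqPairSet hN _ _ _).and (eqPairSet hN _ _ _))))
  · intro v _
    simp only [ZFSet.pair, ZFSet.pair_eq_singleton]
    constructor
    · intro h
      exact ⟨_, by rw [h]; simp, _, by rw [h]; simp, rfl, rfl, h⟩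
    · rintro ⟨x, -, y, -, rfl, rfl, h⟩
      exact h

theorem pairMem (hN : ∀ x ∈ N, ∀ y ∈ x, y ∈ N) (i j k : α) :
    DefinableIn N (fun v => ZFSet.pair (v i) (v j) ∈ v k) :=
  (exMem hN (P := fun p v => p = ZFSet.pair (v i) (v j)) k (eqPair hN _ _ _)).congr fun v _ =>
    ⟨fun h => ⟨_, h, rfl⟩, by rintro ⟨p, hp, rfl⟩; exact hp⟩

theorem subsetOmega (hN : ∀ x ∈ N, ∀ y ∈ x, y ∈ N) (hω : ZFSet.omega ∈ N) (i : α) :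
    DefinableIn N (fun v => v i ⊆ ZFSet.omega) :=
  (ex (P := fun w v => w = ZFSet.omega ∧ v i ⊆ w) ((eqOmega hN _).and (subset hN _ _))).congr
    fun v _ => ⟨fun h => ⟨_, hω, rfl, h⟩, by rintro ⟨w, -, rfl, h⟩; exact h⟩

theorem finiteInter (hN : ∀ x ∈ N, ∀ y ∈ x, y ∈ N) (hω : ZFSet.omega ∈ N) (i j : α) :
    DefinableIn N (fun v => (natsOf (v i) ∩ natsOf (v j)).Finite) := by
  refine congr (P := fun v => ∃ w ∈ N, w = ZFSet.omega ∧
    ∃ n ∈ w, ∀ k ∈ w, k ∈ v i → k ∈ v j → k ∈ n) ?_ ?_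
  · exact ex ((eqOmega hN _).and (exMem hN _ (allMem hN _ ((mem _ _).imp ((mem _ _).imp (mem _ _))))))
  · intro v _
    rw [finite_inter_iff_exists]
    exact ⟨fun h => ⟨_, hω, rfl, h⟩, by rintro ⟨w, -, rfl, h⟩; exact h⟩

theorem infinite (hN : ∀ x ∈ N, ∀ y ∈ x, y ∈ N) (hω : ZFSet.omega ∈ N) (i : α) :
    DefinableIn N (fun v => (natsOf (v i)).Infinite) :=
  (finiteInter hN hω i i).not.congr fun v _ => by rw [Set.inter_self]; rfl

/-- Countability is absolute for H_χ: the graph of an enumeration is a countable set of pairs from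
H_χ, hence itself an element since ℵ₀ < χ. -/
theorem countable {χ : Cardinal.{u}} (hχ : χ.IsRegular) (hχ' : ℵ₀ < χ) (hω : ZFSet.omega ∈ hSet χ)
    (i : α) : DefinableIn (hSet χ) (fun v => (v i : Set ZFSet.{u}).Countable) := by
  have hN := hSet_trans (χ := χ)
  refine congr (P := fun v => ∃ w ∈ hSet χ, w = ZFSet.omega ∧ ∃ e ∈ hSet χ, ∀ z ∈ v i, ∃ n ∈ w,
    ZFSet.pair n z ∈ e ∧ ∀ z' ∈ v i, ZFSet.pair n z' ∈ e → z' = z) ?_ ?_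
  · exact ex ((eqOmega hN _).and (ex (allMem hN _ (exMem hN _ ((pairMem hN _ _ _).and
      (allMem hN _ ((pairMem hN _ _ _).imp (eq _ _))))))))
  · intro v hv
    constructor
    · intro hc
      refine ⟨_, hω, rfl, ?_⟩
      rcases (v i : Set ZFSet.{u}).eq_empty_or_nonempty with h0 | h0
      · refine ⟨_, hω, fun z hz => ?_⟩
        have : z ∈ (v i : Set ZFSet.{u}) := hz
        rw [h0] at this
        exact this.elim
      · obtain ⟨f, hf⟩ := hc.exists_eq_range h0
        have hfi : ∀ n, f n ∈ v i := fun n => by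
          rw [← SetLike.mem_coe, hf]; exact ⟨n, rfl⟩
        refine ⟨ZFSet.range fun n : ℕ => ZFSet.pair (natZF n) (f n),
          range_mem_hSet hχ _ (fun n => pair_mem_hSet hχ (hN _ hω _ (natZF_mem_omega n))
            (hN _ (hv i) _ (hfi n))) (by simpa using hχ'), fun z hz => ?_⟩
        rw [← SetLike.mem_coe, hf] at hz
        obtain ⟨n, rfl⟩ := hz
        refine ⟨natZF n, natZF_mem_omega n, ZFSet.mem_range.2 ⟨n, rfl⟩, fun z' _ hz' => ?_⟩
        obtain ⟨m, hm⟩ := ZFSet.mem_range.1 hz'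
        obtain ⟨h1, h2⟩ := ZFSet.pair_inj.1 hm
        rw [← h2, natZF_injective h1]
    · rintro ⟨w, -, rfl, e, -, he⟩
      choose! f hf using he
      have hinj : Set.InjOn f (v i : Set ZFSet.{u}) := fun x hx y hy hxy =>
        (hf y hy).2.2 x hx (hxy ▸ (hf x hx).2.1)
      refine Set.MapsTo.countable_of_injOn (t := Set.range natZF.{u}) (fun z hz => ?_) hinj
        (Set.countable_range _)
      obtain ⟨n, hn⟩ := mem_omega_iff.1 (hf z hz).1
      exact ⟨n, hn.symm⟩

end DefinableIn

/-! ### Diagonalization against countably many sets of natural numbers -/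

/-- The k-th point is taken beyond 2^k, in the member of D that bookkeeping by `Nat.unpair` assigns
to k, and outside the first k + 1 members of B. Each member of D is served infinitely often; the
growth bound is what later yields sparseness. -/
theorem exists_almostDisjoint_meeting {B D : Set (Set ℕ)} (hB : B.Countable) (hD : D.Countable)
    (hD0 : D.Nonempty) (h : ∀ d ∈ D, ∀ F ⊆ B, F.Finite → (d \ ⋃₀ F).Infinite) :
    ∃ p : ℕ → ℕ, (∀ k, 2 ^ k ≤ p k) ∧ (∀ b ∈ B, (Set.range p ∩ b).Finite) ∧
      ∀ d ∈ D, (Set.range p ∩ d).Infinite := by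
  obtain ⟨b, hb⟩ := (hB.insert ∅).exists_eq_range (Set.insert_nonempty _ _)
  obtain ⟨d, hd⟩ := hD.exists_eq_range hD0
  have hd' : ∀ n, d n ∈ D := fun n => hd ▸ ⟨n, rfl⟩
  have key : ∀ k, ∃ p, 2 ^ k ≤ p ∧ p ∈ d (Nat.unpair k).1 ∧ ∀ i ≤ k, p ∉ b i := by
    intro k
    obtain ⟨p, hp, hp'⟩ := (h _ (hd' (Nat.unpair k).1) (B ∩ b '' Set.Iic k)
      Set.inter_subset_left (((Set.finite_Iic k).image b).inter_of_right B)).exists_gt (2 ^ k)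
    refine ⟨p, hp'.le, hp.1, fun i hi hpi => hp.2 ?_⟩
    have hbi : b i ∈ insert ∅ B := hb ▸ ⟨i, rfl⟩
    rcases hbi with h0 | h0
    · rw [h0] at hpi
      exact hpi.elim
    · exact ⟨b i, ⟨h0, i, hi, rfl⟩, hpi⟩
  choose p hp1 hp2 hp3 using key
  refine ⟨p, hp1, fun c hc => ?_, fun c hc => ?_⟩
  · obtain ⟨i, rfl⟩ : c ∈ Set.range b := hb ▸ Set.mem_insert_of_mem _ hc
    refine ((Set.finite_Iio i).image p).subset ?_
    rintro _ ⟨⟨k, rfl⟩, hk⟩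
    exact ⟨k, lt_of_not_ge fun hik => hp3 k i hik hk, rfl⟩
  · obtain ⟨n, rfl⟩ : c ∈ Set.range d := hd ▸ hc
    refine Set.infinite_of_forall_exists_gt fun m => ?_
    refine ⟨p (Nat.pair n m), ⟨⟨_, rfl⟩, ?_⟩, ?_⟩
    · have := hp2 (Nat.pair n m)
      rwa [Nat.unpair_pair] at this
    · calc m ≤ Nat.pair n m := Nat.right_le_pair n m
        _ < 2 ^ Nat.pair n m := Nat.lt_two_pow_self
        _ ≤ _ := hp1 _

/-- Finitely many members never cover ω up to a finite set, because a further member is almost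
disjoint from each of them. Diagonalization then extends a countable family. -/
theorem IsMADFamily.not_countable {A : Set (Set ℕ)} (hA : IsMADFamily A) : ¬ A.Countable := by
  intro hc
  obtain ⟨⟨hinf, hel, had⟩, hmax⟩ := hA
  obtain ⟨p, -, hp1, hp2⟩ := exists_almostDisjoint_meeting hc (Set.countable_singleton Set.univ)
    (Set.singleton_nonempty _) (by
      rintro _ rfl F hF hFf
      obtain ⟨a, ha, haF⟩ := (hinf.sdiff hFf).nonempty
      have h1 : (a ∩ ⋃₀ F).Finite := by
        rw [Set.sUnion_eq_biUnion, Set.inter_iUnion₂]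
        exact hFf.biUnion fun b hb => had ha (hF hb) fun h => haF (h ▸ hb)
      exact ((hel a ha).sdiff h1).mono fun x hx => ⟨trivial, fun h => hx.2 ⟨hx.1, h⟩⟩)
  have hpi : (Set.range p).Infinite := by simpa using hp2 _ rfl
  have hins : IsAlmostDisjointFamily (insert (Set.range p) A) := by
    refine ⟨hinf.mono (Set.subset_insert _ _), ?_, ?_⟩
    · rintro a (rfl | ha)
      exacts [hpi, hel a ha]
    · refine had.insert fun b hb _ => ⟨hp1 b hb, ?_⟩
      rw [Set.inter_comm]
      exact hp1 b hb
  have hmem : Set.range p ∈ A := hmax hins (Set.subset_insert _ _) (Set.mem_insert _ _)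
  exact hpi (by simpa using hp1 _ hmem)

/-! ### Sparse sets and the recursive selection -/

/-- Sets of natural numbers of logarithmic growth; they form a proper ideal. -/
def IsSparse (a : Set ℕ) : Prop := ∃ C : ℕ, ∀ n, (a ∩ Set.Iio (2 ^ n)).ncard ≤ C * (n + 1)

theorem IsSparse.union {a b : Set ℕ} (ha : IsSparse a) (hb : IsSparse b) : IsSparse (a ∪ b) := by
  obtain ⟨C, hC⟩ := ha
  obtain ⟨D, hD⟩ := hb
  refine ⟨C + D, fun n => ?_⟩
  rw [Set.union_inter_distrib_right, add_mul]
  exact (Set.ncard_union_le _ _).trans (add_le_add (hC n) (hD n))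

theorem isSparse_of_finite {a : Set ℕ} (ha : a.Finite) : IsSparse a :=
  ⟨a.ncard, fun n => (Set.ncard_le_ncard Set.inter_subset_left ha).trans
    (Nat.le_mul_of_pos_right _ n.succ_pos)⟩

theorem isSparse_sUnion {F : Set (Set ℕ)} (hF : F.Finite) (h : ∀ a ∈ F, IsSparse a) :
    IsSparse (⋃₀ F) := by
  induction F, hF using Set.Finite.induction_on with
  | empty => simpa using isSparse_of_finite Set.finite_empty
  | insert _ _ ih =>
    rw [Set.sUnion_insert]
    exact (h _ (Set.mem_insert _ _)).union (ih fun a ha => h a (Set.mem_insert_of_mem _ ha))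

theorem isSparse_range {p : ℕ → ℕ} (hp : ∀ k, 2 ^ k ≤ p k) : IsSparse (Set.range p) := by
  refine ⟨1, fun n => ?_⟩
  have h : Set.range p ∩ Set.Iio (2 ^ n) ⊆ p '' Set.Iio n := by
    rintro _ ⟨⟨k, rfl⟩, hk⟩
    exact ⟨k, (Nat.pow_lt_pow_iff_right (by norm_num)).1 ((hp k).trans_lt hk), rfl⟩
  calc _ ≤ (p '' Set.Iio n).ncard := Set.ncard_le_ncard h ((Set.finite_Iio n).image p)
    _ ≤ (Set.Iio n).ncard := Set.ncard_image_le (Set.finite_Iio n)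
    _ = n := by simp
    _ ≤ _ := by omega

theorem not_isSparse_univ : ¬ IsSparse Set.univ := by
  rintro ⟨C, hC⟩
  -- For this exponent the left side is a square, at least (2C + 2)², which exceeds C(4C + 3).
  have h := hC (2 * (2 * C + 1))
  have h1 : (Set.univ ∩ Set.Iio (2 ^ (2 * (2 * C + 1))) : Set ℕ).ncard = 2 ^ (2 * (2 * C + 1)) := by
    simp
  rw [h1, mul_comm 2, pow_mul] at h
  have h2 : 2 * C + 2 ≤ 2 ^ (2 * C + 1) := Nat.lt_two_pow_self
  nlinarith

theorem IsSparse.infinite_compl {a : Set ℕ} (ha : IsSparse a) : aᶜ.Infinite := fun h =>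
  not_isSparse_univ (by simpa using ha.union (isSparse_of_finite h))

/-- `g` selects, along the relation `R`, almost disjoint sets that meet every set in `D x` which
is not yet trivial with respect to the sets selected before `x`. -/
def IsSelectionAt {α : Type*} (R : α → α → Prop) (D : α → Set (Set ℕ)) (g : α → Set ℕ) (x : α) :
    Prop :=
  (g x).Infinite ∧ (∀ y, R y x → (g x ∩ g y).Finite) ∧
    ∀ d ∈ D x, ∀ X ⊆ d, X.Infinite → (∀ y, R y x → (X ∩ g y).Finite) → (g x ∩ d).Infinite

/-- Recursion on the accessible part of R, diagonalizing at each point against the countably many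
earlier values. -/
theorem exists_selection {α : Type*} (R : α → α → Prop) (D : α → Set (Set ℕ))
    (hR : ∀ x, {y | R y x}.Countable) (hD : ∀ x, (D x).Countable) :
    ∃ g : α → Set ℕ, ∀ x, Acc R x → IsSelectionAt R D g x := by
  -- Cutting R down to accessible points makes it well-founded on all of α, so that g can be total.
  let S : α → α → Prop := fun y x => Acc R x ∧ R y x
  have hS : WellFounded S := by
    refine ⟨fun x => ?_⟩
    by_cases hx : Acc R x
    · induction hx with
      | intro x _ ih => exact ⟨x, fun y hy => ih y hy.2⟩
    · exact ⟨x, fun y hy => absurd hy.1 hx⟩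
  -- Sparseness is carried as part of the induction hypothesis: without it, finitely many earlier
  -- values might cover ω up to a finite set.
  let good : Set (Set ℕ) → Set (Set ℕ) → Set ℕ → Prop := fun B D a => IsSparse a ∧ a.Infinite ∧
    (∀ b ∈ B, (a ∩ b).Finite) ∧
    ∀ d ∈ D, ∀ X ⊆ d, X.Infinite → (∀ b ∈ B, (X ∩ b).Finite) → (a ∩ d).Infinite
  let F : ∀ x, (∀ y, S y x → Set ℕ) → Set ℕ := fun x rec =>
    Classical.epsilon (good {b | ∃ y, ∃ h : S y x, b = rec y h} (D x))
  let g : α → Set ℕ := hS.fix F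
  have hg : ∀ x, g x = Classical.epsilon (good {b | ∃ y, ∃ _ : S y x, b = g y} (D x)) :=
    fun x => hS.fix_eq F x
  have main : ∀ x, Acc R x → good {b | ∃ y, ∃ _ : S y x, b = g y} (D x) (g x) := by
    intro x hx
    induction hx with
    | intro x hacc ih =>
      have hx : Acc R x := ⟨x, hacc⟩
      rw [hg x]
      apply Classical.epsilon_spec
      set B : Set (Set ℕ) := {b | ∃ y, ∃ _ : S y x, b = g y} with hBdef
      have hBs : ∀ b ∈ B, IsSparse b := by
        rintro _ ⟨y, hy, rfl⟩
        exact (ih y hy.2).1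
      have hBc : B.Countable := by
        refine ((hR x).image g).mono ?_
        rintro _ ⟨y, hy, rfl⟩
        exact ⟨y, hy.2, rfl⟩
      -- Meeting `univ` makes the new set infinite. Any other d is kept only if it contains an
      -- infinite X almost disjoint from B, which is exactly what keeps `d \ ⋃₀ E` infinite.
      let D' : Set (Set ℕ) := insert Set.univ
        {d ∈ D x | ∃ X ⊆ d, X.Infinite ∧ ∀ b ∈ B, (X ∩ b).Finite}
      obtain ⟨p, hp1, hp2, hp3⟩ := exists_almostDisjoint_meeting (D := D') hBc
        (((hD x).mono (Set.sep_subset _ _)).insert _) (Set.insert_nonempty _ _) (by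
          rintro d (rfl | ⟨-, X, hXd, hX, hXB⟩) E hE hEf
          · rw [← Set.compl_eq_univ_sdiff]
            exact (isSparse_sUnion hEf fun a ha => hBs a (hE ha)).infinite_compl
          · have h1 : (X ∩ ⋃₀ E).Finite := by
              rw [Set.sUnion_eq_biUnion, Set.inter_iUnion₂]
              exact hEf.biUnion fun b hb => hXB b (hE hb)
            exact (hX.sdiff h1).mono fun z hz => ⟨hXd hz.1, fun h => hz.2 ⟨hz.1, h⟩⟩)
      refine ⟨Set.range p, isSparse_range hp1, ?_, hp2, fun d hd X hXd hX hXB => ?_⟩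
      · simpa using hp3 _ (Set.mem_insert _ _)
      · exact hp3 d (Or.inr ⟨hd, X, hXd, hX, hXB⟩)
  refine ⟨g, fun x hx => ?_⟩
  obtain ⟨-, h1, h2, h3⟩ := main x hx
  refine ⟨h1, fun y hy => h2 _ ⟨y, ⟨hx, hy⟩, rfl⟩, fun d hd X hXd hX hXB => h3 d hd X hXd hX ?_⟩
  rintro _ ⟨y, hy, rfl⟩
  exact hXB y hy.2

/-! ### Countable relations between subsets of `ω` and their initial segments -/

/-- A countable binary relation between subsets of `ω`. -/
def IsCountableRel (E : ZFSet.{u}) : Prop :=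
  (E : Set ZFSet.{u}).Countable ∧
    ∀ z ∈ E, ∃ x y, x ⊆ ZFSet.omega ∧ y ⊆ ZFSet.omega ∧ z = ZFSet.pair x y

/-- The restriction of the relation `E` to the predecessors of `b`. -/
def segment (E b : ZFSet.{u}) : ZFSet.{u} :=
  E.sep fun z => ∃ x y, z = ZFSet.pair x y ∧ ZFSet.pair x b ∈ E ∧ ZFSet.pair y b ∈ E

/-- `E'` is a segment of `E`, different from `E`, below some element of `N`. -/
def IsProperSegment (N : Set ZFSet.{u}) (E' E : ZFSet.{u}) : Prop :=
  E' ≠ E ∧ ∃ b ∈ N, E' = segment E b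

theorem pair_mem_segment {E b x y : ZFSet.{u}} : ZFSet.pair x y ∈ segment E b ↔
    ZFSet.pair x y ∈ E ∧ ZFSet.pair x b ∈ E ∧ ZFSet.pair y b ∈ E := by
  rw [segment, ZFSet.mem_sep]
  refine and_congr_right fun _ => ⟨?_, fun h => ⟨x, y, rfl, h⟩⟩
  rintro ⟨x', y', h, h'⟩
  obtain ⟨rfl, rfl⟩ := ZFSet.pair_inj.1 h
  exact h'

theorem IsProperSegment.subset {N : Set ZFSet.{u}} {E' E : ZFSet.{u}}
    (h : IsProperSegment N E' E) : E' ⊆ E := by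
  obtain ⟨-, b, -, rfl⟩ := h
  exact ZFSet.sep_subset

theorem IsCountableRel.mono {E' E : ZFSet.{u}} (hE : IsCountableRel E) (h : E' ⊆ E) :
    IsCountableRel E' :=
  ⟨hE.1.mono h, fun z hz => hE.2 z (h hz)⟩

theorem countable_field {E : ZFSet.{u}} (hE : (E : Set ZFSet.{u}).Countable) :
    {d | ∃ c, ZFSet.pair c d ∈ E ∨ ZFSet.pair d c ∈ E}.Countable := by
  have h1 : {d | ∃ c, ZFSet.pair c d ∈ E}.Countable := by
    choose! f hf using fun d (h : d ∈ {d | ∃ c, ZFSet.pair c d ∈ E}) => h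
    exact Set.MapsTo.countable_of_injOn (f := fun d => ZFSet.pair (f d) d) hf
      (fun x _ y _ h => (ZFSet.pair_inj.1 h).2) hE
  have h2 : {d | ∃ c, ZFSet.pair d c ∈ E}.Countable := by
    choose! f hf using fun d (h : d ∈ {d | ∃ c, ZFSet.pair d c ∈ E}) => h
    exact Set.MapsTo.countable_of_injOn (f := fun d => ZFSet.pair d (f d)) hf
      (fun x _ y _ h => (ZFSet.pair_inj.1 h).1) hE
  refine (h1.union h2).mono ?_
  rintro d ⟨c, h | h⟩
  exacts [Or.inl ⟨c, h⟩, Or.inr ⟨c, h⟩]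

/-- A nonempty segment is determined by a point of the countable field of E. -/
theorem countable_properSegment {N : Set ZFSet.{u}} {E : ZFSet.{u}}
    (hE : (E : Set ZFSet.{u}).Countable) : {E' | IsProperSegment N E' E}.Countable := by
  refine (((countable_field hE).image (segment E)).insert ∅).mono ?_
  rintro _ ⟨-, b, -, rfl⟩
  rcases (segment E b).eq_empty_or_nonempty with h | ⟨z, hz⟩
  · exact Or.inl h
  · obtain ⟨x, y, -, h, -⟩ := (ZFSet.mem_sep.1 hz).2
    exact Or.inr ⟨b, ⟨x, Or.inl h⟩, rfl⟩

/-- The binary relation between subsets of `ω` enumerated by `c`. -/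
noncomputable def enumRel (c : ℕ → Option (Set ℕ × Set ℕ)) : ZFSet.{u} :=
  ZFSet.range fun q : {q : Set ℕ × Set ℕ // ∃ n, c n = some q} =>
    ZFSet.pair (subsetZF q.1.1) (subsetZF q.1.2)

theorem isCountableRel_enumRel (c : ℕ → Option (Set ℕ × Set ℕ)) :
    IsCountableRel (enumRel.{u} c) := by
  constructor
  · rw [enumRel, ZFSet.coe_range]
    have : Countable {q : Set ℕ × Set ℕ // ∃ n, c n = some q} := by
      choose f hf using fun q : {q : Set ℕ × Set ℕ // ∃ n, c n = some q} => q.2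
      refine Function.Injective.countable (f := f) fun x y h => ?_
      have := hf x
      rw [h, hf y] at this
      exact Subtype.ext (Option.some_injective _ this).symm
    exact Set.countable_range _
  · intro z hz
    obtain ⟨q, rfl⟩ := ZFSet.mem_range.1 hz
    exact ⟨_, _, subsetZF_subset _, subsetZF_subset _, rfl⟩

/-- Indexing countable relations by sequences of pairs bounds their number by 𝔠; the value `none`
accommodates the empty relation. -/
theorem IsCountableRel.exists_enumRel {E : ZFSet.{u}} (hE : IsCountableRel E) :
    ∃ c, enumRel.{u} c = E := by
  let T : Set (Set ℕ × Set ℕ) := {q | ZFSet.pair (subsetZF.{u} q.1) (subsetZF q.2) ∈ E}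
  have hinj : Function.Injective
      fun q : Set ℕ × Set ℕ => ZFSet.pair (subsetZF.{u} q.1) (subsetZF q.2) := by
    intro p q h
    obtain ⟨h1, h2⟩ := ZFSet.pair_inj.1 h
    refine Prod.ext ?_ ?_
    · rw [← natsOf_subsetZF.{u} p.1, h1, natsOf_subsetZF]
    · rw [← natsOf_subsetZF.{u} p.2, h2, natsOf_subsetZF]
  have hmaps : Set.MapsTo (fun q : Set ℕ × Set ℕ => ZFSet.pair (subsetZF.{u} q.1) (subsetZF q.2))
      T (E : Set ZFSet.{u}) := fun _ h => h
  have hT : T.Countable := hmaps.countable_of_injOn hinj.injOn hE.1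
  obtain ⟨c, hc⟩ := ((hT.image some).insert none).exists_eq_range (Set.insert_nonempty _ _)
  have hcT : ∀ q, (∃ n, c n = some q) ↔ q ∈ T := by
    intro q
    change some q ∈ Set.range c ↔ _
    rw [← hc]
    simp
  refine ⟨c, ?_⟩
  ext z
  rw [enumRel, ZFSet.mem_range]
  constructor
  · rintro ⟨⟨q, hq⟩, rfl⟩
    exact (hcT q).1 hq
  · intro hz
    obtain ⟨x, y, hx, hy, rfl⟩ := hE.2 z hz
    refine ⟨⟨(natsOf x, natsOf y), (hcT _).2 ?_⟩, ?_⟩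
    · change ZFSet.pair (subsetZF (natsOf x)) (subsetZF (natsOf y)) ∈ E
      rwa [subsetZF_natsOf hx, subsetZF_natsOf hy]
    · change ZFSet.pair (subsetZF (natsOf x)) (subsetZF (natsOf y)) = _
      rw [subsetZF_natsOf hx, subsetZF_natsOf hy]

/-! ### Selectors -/

/-- `G` is a function (a set of pairs) whose domain contains every countable relation between
subsets of `ω` all of whose proper segments it contains. The values of `G` are almost disjoint
along proper segments, and `G E` meets every `d` in the field of `E` that contains an infinite set
almost disjoint from the values of `G` at the proper segments of `E`. -/
structure IsSelector (N : Set ZFSet.{u}) (G : ZFSet.{u}) : Prop where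
  exists_value : ∀ E ∈ N, IsCountableRel E →
    (∀ E' ∈ N, IsProperSegment N E' E → ∃ a ∈ N, ZFSet.pair E' a ∈ G) →
      ∃ a ∈ N, ZFSet.pair E a ∈ G
  unique : ∀ E ∈ N, ∀ a ∈ N, ∀ a' ∈ N, ZFSet.pair E a ∈ G → ZFSet.pair E a' ∈ G → a = a'
  subset_omega : ∀ E ∈ N, ∀ a ∈ N, ZFSet.pair E a ∈ G → a ⊆ ZFSet.omega
  infinite : ∀ E ∈ N, ∀ a ∈ N, ZFSet.pair E a ∈ G → (natsOf a).Infinite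
  finite_inter : ∀ E ∈ N, ∀ a ∈ N, ZFSet.pair E a ∈ G →
    ∀ E' ∈ N, IsProperSegment N E' E → ∀ a' ∈ N, ZFSet.pair E' a' ∈ G →
      (natsOf a ∩ natsOf a').Finite
  not_finite_inter : ∀ E ∈ N, ∀ a ∈ N, ZFSet.pair E a ∈ G →
    ∀ d ∈ N, (∃ c ∈ N, ZFSet.pair c d ∈ E ∨ ZFSet.pair d c ∈ E) →
      ∀ X ∈ N, X ⊆ d → (natsOf X).Infinite →
        (∀ E' ∈ N, IsProperSegment N E' E → ∀ a' ∈ N, ZFSet.pair E' a' ∈ G →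
          (natsOf X ∩ natsOf a').Finite) → ¬ (natsOf a ∩ natsOf d).Finite

section hSet

variable {χ : Cardinal.{u}}

theorem mem_of_pair_mem {N : Set ZFSet.{u}} (hN : ∀ x ∈ N, ∀ y ∈ x, y ∈ N) {x y : ZFSet.{u}}
    (h : ZFSet.pair x y ∈ N) : x ∈ N ∧ y ∈ N := by
  have h1 : ({x, y} : ZFSet.{u}) ∈ N := hN _ h _ (by simp [ZFSet.pair])
  exact ⟨hN _ h1 _ (by simp), hN _ h1 _ (by simp)⟩

theorem omega_mem_hSet (h : ZFSet.powerset ZFSet.omega.{u} ∈ hSet χ) : ZFSet.omega ∈ hSet χ :=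
  hSet_trans _ h _ (ZFSet.mem_powerset.2 fun _ hx => hx)

theorem continuum_lt_of_powerset_omega_mem_hSet
    (h : ZFSet.powerset ZFSet.omega.{u} ∈ hSet χ) : 𝔠 < χ := by
  have h1 := mk_lt_of_mem_hSet h
  let f : Set ℕ → (ZFSet.powerset ZFSet.omega.{u} : Set ZFSet.{u}) := fun a =>
    ⟨subsetZF a, ZFSet.mem_powerset.2 (subsetZF_subset a)⟩
  have hf : Function.Injective f := fun a b hab => by
    rw [← natsOf_subsetZF.{u} a, ← natsOf_subsetZF.{u} b]
    exact congrArg natsOf (congrArg Subtype.val hab)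
  have h2 := (Cardinal.lift_mk_le'.2 ⟨⟨f, hf⟩⟩).trans_lt (Cardinal.lift_lt.2 h1)
  rw [Cardinal.mk_set, Cardinal.mk_nat, Cardinal.two_power_aleph0, Cardinal.lift_continuum,
    Cardinal.lift_lift, ← Cardinal.lift_continuum.{u + 1, u}, Cardinal.lift_lt] at h2
  exact h2

theorem mk_enumeration_le : #(ℕ → Option (Set ℕ × Set ℕ)) ≤ 𝔠 := by
  simp [Cardinal.add_one_eq Cardinal.aleph0_le_continuum]

/-- An arbitrary countable relation need not be well-founded, so G is defined on the accessible part
of the proper-segment relation. This domain has the closure property `exists_value`, which is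
first-order, whereas accessibility is not visibly so. -/
theorem exists_isSelector (hχ : χ.IsRegular) (h : ZFSet.powerset ZFSet.omega.{u} ∈ hSet χ) :
    ∃ G ∈ hSet χ, IsSelector (hSet χ) G := by
  have hN := hSet_trans (χ := χ)
  have hω := omega_mem_hSet h
  have hc := continuum_lt_of_powerset_omega_mem_hSet h
  have hsub : ∀ a, subsetZF.{u} a ∈ hSet χ := fun a => hSet_of_subset hω (subsetZF_subset a)
  let R : ZFSet.{u} → ZFSet.{u} → Prop := fun E' E =>
    IsCountableRel E ∧ IsProperSegment (hSet χ) E' E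
  let D : ZFSet.{u} → Set (Set ℕ) := fun E => {d | IsCountableRel E ∧
    d ∈ natsOf '' {d | ∃ c, ZFSet.pair c d ∈ E ∨ ZFSet.pair d c ∈ E}}
  obtain ⟨g, hg⟩ := exists_selection R D
    (fun E => by
      by_cases hE : IsCountableRel E
      · exact (countable_properSegment hE.1).mono fun _ h => h.2
      · exact Set.countable_empty.mono fun _ h => hE h.1)
    (fun E => by
      by_cases hE : IsCountableRel E
      · exact ((countable_field hE.1).image natsOf).mono fun _ h => h.2
      · exact Set.countable_empty.mono fun _ h => hE h.1)
  let G : ZFSet.{u} := ZFSet.range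
    fun c : {c : ℕ → Option (Set ℕ × Set ℕ) // Acc R (enumRel c)} =>
      ZFSet.pair (enumRel c.1) (subsetZF (g (enumRel c.1)))
  have hG : ∀ E a, ZFSet.pair E a ∈ G ↔ IsCountableRel E ∧ Acc R E ∧ a = subsetZF (g E) := by
    intro E a
    rw [ZFSet.mem_range]
    constructor
    · rintro ⟨⟨c, hc⟩, h⟩
      obtain ⟨rfl, rfl⟩ := ZFSet.pair_inj.1 h
      exact ⟨isCountableRel_enumRel c, hc, rfl⟩
    · rintro ⟨hE, hacc, rfl⟩
      obtain ⟨c, rfl⟩ := hE.exists_enumRel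
      exact ⟨⟨c, hacc⟩, rfl⟩
  have hseg : ∀ {E E'}, IsCountableRel E → Acc R E → IsProperSegment (hSet χ) E' E →
      ZFSet.pair E' (subsetZF (g E')) ∈ G := fun hE hacc hE' =>
    (hG _ _).2 ⟨hE.mono hE'.subset, hacc.inv ⟨hE, hE'⟩, rfl⟩
  refine ⟨G, ?_, ?_, ?_, ?_, ?_, ?_, ?_⟩
  · refine range_mem_hSet hχ _ (fun c => pair_mem_hSet hχ ?_ (hsub _)) ?_
    · refine range_mem_hSet hχ _ (fun q => pair_mem_hSet hχ (hsub _) (hsub _)) ?_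
      refine lt_of_le_of_lt ?_ hc
      rw [← Cardinal.lift_continuum.{u, 0}, Cardinal.lift_le]
      exact (Cardinal.mk_subtype_le _).trans (by simp)
    · refine lt_of_le_of_lt ?_ hc
      rw [← Cardinal.lift_continuum.{u, 0}, Cardinal.lift_le]
      exact (Cardinal.mk_subtype_le _).trans mk_enumeration_le
  · intro E hE hEc hpred
    refine ⟨_, hsub _, (hG _ _).2 ⟨hEc, ⟨_, fun E' hE' => ?_⟩, rfl⟩⟩
    obtain ⟨a, -, ha⟩ := hpred E' (hSet_of_subset hE hE'.2.subset) hE'.2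
    exact ((hG _ _).1 ha).2.1
  · intro E _ a _ a' _ h1 h2
    rw [((hG _ _).1 h1).2.2, ((hG _ _).1 h2).2.2]
  · intro E _ a _ h1
    rw [((hG _ _).1 h1).2.2]
    exact subsetZF_subset _
  · intro E _ a _ h1
    obtain ⟨-, h3, rfl⟩ := (hG _ _).1 h1
    rw [natsOf_subsetZF]
    exact (hg E h3).1
  · intro E _ a _ h1 E' _ hE' a' _ h1'
    obtain ⟨h2, h3, rfl⟩ := (hG _ _).1 h1
    obtain ⟨-, -, rfl⟩ := (hG _ _).1 h1'
    rw [natsOf_subsetZF, natsOf_subsetZF]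
    exact (hg E h3).2.1 E' ⟨h2, hE'⟩
  · intro E hE a _ h1 d _ hd X _ hXd hX hXE
    obtain ⟨h2, h3, rfl⟩ := (hG _ _).1 h1
    rw [natsOf_subsetZF]
    obtain ⟨c, -, hd⟩ := hd
    refine (hg E h3).2.2 _ ⟨h2, d, ⟨c, hd⟩, rfl⟩ (natsOf X) (natsOf_mono hXd) hX fun E' hE' => ?_
    have := hXE E' (hSet_of_subset hE hE'.2.subset) hE'.2 _ (hsub _) (hseg h2 h3 hE'.2)
    rwa [natsOf_subsetZF] at this

/-! ### Definability of segments and selectors -/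

namespace DefinableIn

variable {α : Type}

theorem eqSegment {N : Set ZFSet.{u}} (hN : ∀ x ∈ N, ∀ y ∈ x, y ∈ N) (i j k : α) :
    DefinableIn N (fun v => v i = segment (v j) (v k)) := by
  refine congr (P := fun v =>
    (∀ z ∈ v i, z ∈ v j ∧ ∃ x ∈ N, ∃ y ∈ N, z = ZFSet.pair x y ∧
      ZFSet.pair x (v k) ∈ v j ∧ ZFSet.pair y (v k) ∈ v j) ∧
    ∀ z ∈ v j, (∃ x ∈ N, ∃ y ∈ N, z = ZFSet.pair x y ∧
      ZFSet.pair x (v k) ∈ v j ∧ ZFSet.pair y (v k) ∈ v j) → z ∈ v i) ?_ ?_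
  · have h : ∀ {β : Type} (z j k : β), DefinableIn N (fun v => ∃ x ∈ N, ∃ y ∈ N,
        v z = ZFSet.pair x y ∧ ZFSet.pair x (v k) ∈ v j ∧ ZFSet.pair y (v k) ∈ v j) :=
      fun z j k => ex (ex ((eqPair hN _ _ _).and ((pairMem hN _ _ _).and (pairMem hN _ _ _))))
    exact (allMem hN _ ((mem _ _).and (h _ _ _))).and (allMem hN _ ((h _ _ _).imp (mem _ _)))
  · intro v hv
    have h : ∀ z ∈ v j, ((∃ x y, z = ZFSet.pair x y ∧
        ZFSet.pair x (v k) ∈ v j ∧ ZFSet.pair y (v k) ∈ v j) ↔ (∃ x ∈ N, ∃ y ∈ N,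
        z = ZFSet.pair x y ∧ ZFSet.pair x (v k) ∈ v j ∧ ZFSet.pair y (v k) ∈ v j)) := by
      intro z hz
      constructor
      · rintro ⟨x, y, rfl, h⟩
        obtain ⟨hx, hy⟩ := mem_of_pair_mem hN (hN _ (hv j) _ hz)
        exact ⟨x, hx, y, hy, rfl, h⟩
      · rintro ⟨x, -, y, -, h⟩
        exact ⟨x, y, h⟩
    constructor
    · intro he
      rw [he]
      exact ⟨fun z hz => ⟨(ZFSet.mem_sep.1 hz).1, (h z (ZFSet.mem_sep.1 hz).1).1 (ZFSet.mem_sep.1 hz).2⟩,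
        fun z hz hz' => ZFSet.mem_sep.2 ⟨hz, (h z hz).2 hz'⟩⟩
    · rintro ⟨h1, h2⟩
      ext z
      rw [segment, ZFSet.mem_sep]
      exact ⟨fun hz => ⟨(h1 z hz).1, (h z (h1 z hz).1).2 (h1 z hz).2⟩,
        fun hz => h2 z hz.1 ((h z hz.1).1 hz.2)⟩

theorem isProperSegment {N : Set ZFSet.{u}} (hN : ∀ x ∈ N, ∀ y ∈ x, y ∈ N) (i j : α) :
    DefinableIn N (fun v => IsProperSegment N (v i) (v j)) :=
  (eq _ _).not.and (ex (eqSegment hN _ _ _))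

theorem isPairOfSubsets {N : Set ZFSet.{u}} (hN : ∀ x ∈ N, ∀ y ∈ x, y ∈ N)
    (hω : ZFSet.omega ∈ N) (i : α) : DefinableIn N
      (fun v => ∃ x y, x ⊆ ZFSet.omega ∧ y ⊆ ZFSet.omega ∧ v i = ZFSet.pair x y) := by
  refine congr (P := fun v => ∃ x ∈ N, ∃ y ∈ N,
    x ⊆ ZFSet.omega ∧ y ⊆ ZFSet.omega ∧ v i = ZFSet.pair x y)
    (ex (ex ((subsetOmega hN hω _).and ((subsetOmega hN hω _).and (eqPair hN _ _ _))))) ?_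
  intro v hv
  constructor
  · rintro ⟨x, y, hx, hy, h⟩
    obtain ⟨hx', hy'⟩ := mem_of_pair_mem hN (h ▸ hv i)
    exact ⟨x, hx', y, hy', hx, hy, h⟩
  · rintro ⟨x, -, y, -, h⟩
    exact ⟨x, y, h⟩

theorem isCountableRel (hχ : χ.IsRegular) (hχ' : ℵ₀ < χ) (hω : ZFSet.omega ∈ hSet χ) (i : α) :
    DefinableIn (hSet χ) (fun v => IsCountableRel (v i)) :=
  (countable hχ hχ' hω i).and (allMem hSet_trans _ (isPairOfSubsets hSet_trans hω _))

theorem isSelector (hχ : χ.IsRegular) (hχ' : ℵ₀ < χ) (hω : ZFSet.omega ∈ hSet χ) (i : α) :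
    DefinableIn (hSet χ) (fun v => IsSelector (hSet χ) (v i)) := by
  have hN := hSet_trans (χ := χ)
  refine congr (P := fun v =>
    (∀ E ∈ hSet χ, IsCountableRel E →
      (∀ E' ∈ hSet χ, IsProperSegment (hSet χ) E' E → ∃ a ∈ hSet χ, ZFSet.pair E' a ∈ v i) →
        ∃ a ∈ hSet χ, ZFSet.pair E a ∈ v i) ∧
    (∀ E ∈ hSet χ, ∀ a ∈ hSet χ, ∀ a' ∈ hSet χ,
      ZFSet.pair E a ∈ v i → ZFSet.pair E a' ∈ v i → a = a') ∧
    (∀ E ∈ hSet χ, ∀ a ∈ hSet χ, ZFSet.pair E a ∈ v i → a ⊆ ZFSet.omega) ∧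
    (∀ E ∈ hSet χ, ∀ a ∈ hSet χ, ZFSet.pair E a ∈ v i → (natsOf a).Infinite) ∧
    (∀ E ∈ hSet χ, ∀ a ∈ hSet χ, ZFSet.pair E a ∈ v i →
      ∀ E' ∈ hSet χ, IsProperSegment (hSet χ) E' E → ∀ a' ∈ hSet χ, ZFSet.pair E' a' ∈ v i →
        (natsOf a ∩ natsOf a').Finite) ∧
    (∀ E ∈ hSet χ, ∀ a ∈ hSet χ, ZFSet.pair E a ∈ v i →
      ∀ d ∈ hSet χ, (∃ c ∈ hSet χ, ZFSet.pair c d ∈ E ∨ ZFSet.pair d c ∈ E) →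
        ∀ X ∈ hSet χ, X ⊆ d → (natsOf X).Infinite →
          (∀ E' ∈ hSet χ, IsProperSegment (hSet χ) E' E → ∀ a' ∈ hSet χ,
            ZFSet.pair E' a' ∈ v i → (natsOf X ∩ natsOf a').Finite) →
          ¬ (natsOf a ∩ natsOf d).Finite)) ?_ ?_
  · refine and ?_ (and ?_ (and ?_ (and ?_ (and ?_ ?_))))
    · exact all ((isCountableRel hχ hχ' hω _).imp ((all ((isProperSegment hN _ _).imp
        (ex (pairMem hN _ _ _)))).imp (ex (pairMem hN _ _ _))))
    · exact all (all (all ((pairMem hN _ _ _).imp ((pairMem hN _ _ _).imp (eq _ _)))))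
    · exact all (all ((pairMem hN _ _ _).imp (subsetOmega hN hω _)))
    · exact all (all ((pairMem hN _ _ _).imp (DefinableIn.infinite hN hω _)))
    · exact all (all ((pairMem hN _ _ _).imp (all ((isProperSegment hN _ _).imp
        (all ((pairMem hN _ _ _).imp (finiteInter hN hω _ _)))))))
    · exact all (all ((pairMem hN _ _ _).imp (all ((ex ((pairMem hN _ _ _).or
        (pairMem hN _ _ _))).imp (all ((subset hN _ _).imp ((DefinableIn.infinite hN hω _).imp
        ((all ((isProperSegment hN _ _).imp (all ((pairMem hN _ _ _).imp
          (finiteInter hN hω _ _))))).imp (finiteInter hN hω _ _).not))))))))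
  · intro v _
    exact ⟨fun ⟨h1, h2, h3, h4, h5, h6⟩ => ⟨h1, h2, h3, h4, h5, h6⟩,
      fun ⟨h1, h2, h3, h4, h5, h6⟩ => ⟨h1, h2, h3, h4, h5, h6⟩⟩

end DefinableIn

end hSet

/-! ### Well-orders of type `ω₁` -/

theorem countable_iff_mk_lt_aleph_one {α : Type*} (s : Set α) : s.Countable ↔ #s < ℵ₁ := by
  rw [Cardinal.lt_aleph_one_iff, Cardinal.le_aleph0_iff_set_countable]

theorem countable_setOf_lt_of_type_eq_omega_one {α : Type*} {r : α → α → Prop} [IsWellOrder α r]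
    (h : Ordinal.type r = Ordinal.omega 1) (x : α) : {y | r y x}.Countable := by
  rw [countable_iff_mk_lt_aleph_one]
  have h1 := Ordinal.typein_lt_type r x
  rw [h, Cardinal.lt_omega_iff_card_lt, Ordinal.card_typein] at h1
  exact h1

/-- If C were unbounded, the countable closed initial segments determined by its points would cover
the uncountable set α. -/
theorem exists_forall_rel_of_countable {α : Type*} {r : α → α → Prop} [IsWellOrder α r]
    (h : Ordinal.type r = Ordinal.omega 1) {C : Set α} (hC : C.Countable) : ∃ x, ∀ c ∈ C, r c x := by
  have hα : ¬ (Set.univ : Set α).Countable := by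
    rw [countable_iff_mk_lt_aleph_one, Cardinal.mk_univ, ← Ordinal.card_type r, h]
    simp
  by_contra! hx
  refine hα ((hC.biUnion fun c _ =>
    (countable_setOf_lt_of_type_eq_omega_one h c).insert c).mono fun x _ => ?_)
  obtain ⟨c, hc, hcx⟩ := hx x
  refine Set.mem_biUnion hc ?_
  rcases trichotomous_of r c x with h1 | h1 | h1
  · exact absurd h1 hcx
  · exact Or.inl h1.symm
  · exact Or.inr h1

/-! ### The relations coded by the initial segments of a well-order -/

/-- `E x` is the restriction of the well-order `r` to the subsets of `ω` below `x`. -/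
def IsSegmentMap (M : Set ZFSet.{u}) (r : M → M → Prop) (E : M → ZFSet.{u}) : Prop :=
  ∀ (x : M) (z : ZFSet.{u}), z ∈ E x ↔ ∃ y w : M, r y w ∧ r w x ∧
    (y : ZFSet.{u}) ⊆ ZFSet.omega ∧ (w : ZFSet.{u}) ⊆ ZFSet.omega ∧ z = ZFSet.pair y w

namespace IsSegmentMap

variable {M : Set ZFSet.{u}} {r : M → M → Prop} {E : M → ZFSet.{u}}

theorem pair_mem_iff (hE : IsSegmentMap M r E) {x : M} {y w : ZFSet.{u}} :
    ZFSet.pair y w ∈ E x ↔ ∃ (hy : y ∈ M) (hw : w ∈ M), r ⟨y, hy⟩ ⟨w, hw⟩ ∧ r ⟨w, hw⟩ x ∧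
      y ⊆ ZFSet.omega ∧ w ⊆ ZFSet.omega := by
  rw [hE]
  constructor
  · rintro ⟨y', w', h1, h2, h3, h4, h⟩
    obtain ⟨rfl, rfl⟩ := ZFSet.pair_inj.1 h
    exact ⟨y'.2, w'.2, h1, h2, h3, h4⟩
  · rintro ⟨hy, hw, h1, h2, h3, h4⟩
    exact ⟨⟨y, hy⟩, ⟨w, hw⟩, h1, h2, h3, h4, rfl⟩

variable [IsWellOrder M r]

theorem subset (hE : IsSegmentMap M r E) {x y : M} (h : r y x) : E y ⊆ E x := by
  intro z hz
  rw [hE] at hz ⊢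
  obtain ⟨y', w', h1, h2, h3⟩ := hz
  exact ⟨y', w', h1, trans_of r h2 h, h3⟩

/-- For b below x, the pairs of `E x` with second entry b list exactly the subsets of ω before b, so
`E x` alone recovers its own initial segments. -/
theorem segment_eq (hE : IsSegmentMap M r E) {x b : M} (h : r b x)
    (hb : (b : ZFSet.{u}) ⊆ ZFSet.omega) : segment (E x) b = E b := by
  ext z
  constructor
  · intro hz
    obtain ⟨y, w, -, -, -, -, rfl⟩ := (hE x z).1 (ZFSet.mem_sep.1 hz).1
    obtain ⟨h1, h2, h3⟩ := pair_mem_segment.1 hz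
    obtain ⟨hy, hw, h1, -, h1'⟩ := hE.pair_mem_iff.1 h1
    obtain ⟨_, _, h3, -, -⟩ := hE.pair_mem_iff.1 h3
    exact hE.pair_mem_iff.2 ⟨hy, hw, h1, h3, h1'⟩
  · intro hz
    obtain ⟨y, w, h1, h2, h3, h4, rfl⟩ := (hE b z).1 hz
    exact pair_mem_segment.2 ⟨hE.subset h hz,
      hE.pair_mem_iff.2 ⟨y.2, b.2, trans_of r h1 h2, h, h3, hb⟩,
      hE.pair_mem_iff.2 ⟨w.2, b.2, h2, h, h4, hb⟩⟩

/-- If b is not a subset of ω in M below x, the segment is empty and is attained at the least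
element of M; that element is not x, because a proper segment differs from `E x`. -/
theorem exists_of_isProperSegment (hE : IsSegmentMap M r E) {N : Set ZFSet.{u}} {x : M}
    {E' : ZFSet.{u}} (h : IsProperSegment N E' (E x)) : ∃ y, r y x ∧ E' = E y := by
  obtain ⟨hne, b, -, rfl⟩ := h
  by_cases hb : ∃ hb : b ∈ M, r ⟨b, hb⟩ x ∧ b ⊆ ZFSet.omega
  · obtain ⟨hbM, hbx, hbω⟩ := hb
    exact ⟨⟨b, hbM⟩, hbx, hE.segment_eq (b := ⟨b, hbM⟩) hbx hbω⟩
  · have h0 : segment (E x) b = ∅ := by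
      refine (ZFSet.eq_empty _).2 fun z hz => hb ?_
      obtain ⟨y, w, -, h1, -⟩ := (ZFSet.mem_sep.1 hz).2
      obtain ⟨-, hbM, -, h2, -, h3⟩ := hE.pair_mem_iff.1 h1
      exact ⟨hbM, h2, h3⟩
    obtain ⟨m, -, hm⟩ := (IsWellFounded.wf : WellFounded r).has_min Set.univ ⟨x, trivial⟩
    have hEm : E m = ∅ := by
      refine (ZFSet.eq_empty _).2 fun z hz => ?_
      obtain ⟨y, w, -, h1, -⟩ := (hE m z).1 hz
      exact hm w trivial h1
    rcases trichotomous_of r m x with h1 | h1 | h1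
    · exact ⟨m, h1, h0.trans hEm.symm⟩
    · subst h1
      exact absurd (h0.trans hEm.symm) hne
    · exact absurd h1 (hm x trivial)

/-- Points of M outside 𝒫(ω) leave `E` unchanged, so y may be replaced by the first subset of ω at
or after it. -/
theorem eq_or_isProperSegment (hE : IsSegmentMap M r E) {N : Set ZFSet.{u}} (hMN : M ⊆ N) {x y : M}
    (h : r y x) : E y = E x ∨ IsProperSegment N (E y) (E x) := by
  refine or_iff_not_imp_left.2 fun hne => ?_
  have hex : {b : M | ¬ r b y ∧ r b x ∧ (b : ZFSet.{u}) ⊆ ZFSet.omega}.Nonempty := by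
    by_contra hemp
    rw [Set.not_nonempty_iff_eq_empty] at hemp
    refine hne (ZFSet.ext fun z => ⟨fun hz => hE.subset h hz, fun hz => ?_⟩)
    obtain ⟨u, w, h1, h2, h3, h4, rfl⟩ := (hE x z).1 hz
    refine hE.pair_mem_iff.2 ⟨u.2, w.2, h1, ?_, h3, h4⟩
    by_contra hw
    exact Set.notMem_empty w (hemp ▸ ⟨hw, h2, h4⟩)
  obtain ⟨b, ⟨hby, hbx, hbω⟩, hmin⟩ := (IsWellFounded.wf : WellFounded r).has_min _ hex
  have hEb : E y = E b := by
    refine ZFSet.ext fun z => ⟨fun hz => ?_, fun hz => ?_⟩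
    · rcases trichotomous_of r b y with h1 | h1 | h1
      · exact absurd h1 hby
      · rwa [h1]
      · exact hE.subset h1 hz
    · obtain ⟨u, w, h1, h2, h3, h4, rfl⟩ := (hE b z).1 hz
      refine hE.pair_mem_iff.2 ⟨u.2, w.2, h1, ?_, h3, h4⟩
      by_contra hw
      exact hmin w ⟨hw, trans_of r h2 hbx, h4⟩ h2
  exact ⟨hne, b, hMN b.2, by rw [hE.segment_eq hbx hbω, hEb]⟩

theorem isCountableRel (hE : IsSegmentMap M r E) (hr : Ordinal.type r = Ordinal.omega 1) (x : M) :
    IsCountableRel (E x) := by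
  constructor
  · have hc := countable_setOf_lt_of_type_eq_omega_one hr x
    refine (hc.image2 hc fun y w : M => ZFSet.pair y w).mono fun z hz => ?_
    obtain ⟨y, w, h1, h2, -, -, rfl⟩ := (hE x z).1 hz
    exact ⟨y, trans_of r h1 h2, w, h2, rfl⟩
  · intro z hz
    obtain ⟨y, w, -, -, h3, h4, rfl⟩ := (hE x z).1 hz
    exact ⟨y, w, h3, h4, rfl⟩

end IsSegmentMap

/-! ### Elements of approachable models -/

section Elementary

variable {χ : Cardinal.{u}} {M : Set ZFSet.{u}}

theorem IsElementarySubmodel.empty_mem (hM : IsElementarySubmodel M (hSet χ))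
    (hω : ZFSet.omega ∈ hSet χ) : ∅ ∈ M := by
  obtain ⟨t, htM, ht⟩ := hM.exists_mem (α := Empty) (P := fun t _ => ∀ x ∈ t, ¬ x = x)
    (DefinableIn.allMem hSet_trans _ (DefinableIn.eq _ _).not) Empty.elim (fun a => a.elim)
    ⟨∅, hSet_trans _ hω _ ZFSet.omega_zero, by simp⟩
  rwa [(ZFSet.eq_empty t).2 fun x hx => ht x hx rfl] at htM

theorem IsElementarySubmodel.omega_sdiff_mem (hM : IsElementarySubmodel M (hSet χ))
    (hω : ZFSet.omega ∈ hSet χ) {a : ZFSet.{u}} (ha : a ∈ M) : ZFSet.omega \ a ∈ M := by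
  have hN := hSet_trans (χ := χ)
  obtain ⟨t, htM, w, -, rfl, ht1, ht2⟩ := hM.exists_mem (α := Unit)
    (P := fun t v => ∃ w ∈ hSet χ, w = ZFSet.omega ∧ (∀ x ∈ t, x ∈ w ∧ ¬ x ∈ v ()) ∧
      ∀ x ∈ w, ¬ x ∈ v () → x ∈ t)
    (DefinableIn.ex ((DefinableIn.eqOmega hN _).and
      ((DefinableIn.allMem hN _ ((DefinableIn.mem _ _).and (DefinableIn.mem _ _).not)).and
        (DefinableIn.allMem hN _ ((DefinableIn.mem _ _).not.imp (DefinableIn.mem _ _))))))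
    (fun _ => a) (fun _ => ha)
    ⟨ZFSet.omega \ a, hSet_of_subset hω (fun x hx => (ZFSet.mem_sdiff.1 hx).1), _, hω, rfl,
      fun x hx => ZFSet.mem_sdiff.1 hx, fun x hx hx' => ZFSet.mem_sdiff.2 ⟨hx, hx'⟩⟩
  have : t = ZFSet.omega \ a := ZFSet.ext fun x => ⟨fun hx => ZFSet.mem_sdiff.2 (ht1 x hx),
    fun hx => ht2 x (ZFSet.mem_sdiff.1 hx).1 (ZFSet.mem_sdiff.1 hx).2⟩
  rwa [← this]

theorem IsElementarySubmodel.exists_isSelector (hM : IsElementarySubmodel M (hSet χ))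
    (hχ : χ.IsRegular) (h : ZFSet.powerset ZFSet.omega.{u} ∈ hSet χ) :
    ∃ G ∈ M, IsSelector (hSet χ) G :=
  hM.exists_mem (α := Empty) (P := fun t _ => IsSelector (hSet χ) t)
    (DefinableIn.isSelector hχ (Cardinal.aleph0_lt_continuum.trans
      (continuum_lt_of_powerset_omega_mem_hSet h)) (omega_mem_hSet h) _)
    Empty.elim (fun a => a.elim) (SepVariant.exists_isSelector hχ h)

theorem IsElementarySubmodel.sep_pairs_mem (hM : IsElementarySubmodel M (hSet χ))
    (hω : ZFSet.omega ∈ hSet χ) {s : ZFSet.{u}} (hs : s ∈ M) :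
    s.sep (fun z => ∃ x y, x ⊆ ZFSet.omega ∧ y ⊆ ZFSet.omega ∧ z = ZFSet.pair x y) ∈ M := by
  have hN := hSet_trans (χ := χ)
  obtain ⟨t, htM, ht1, ht2⟩ := hM.exists_mem (α := Unit)
    (P := fun t v => (∀ z ∈ t, z ∈ v () ∧
      ∃ x y, x ⊆ ZFSet.omega ∧ y ⊆ ZFSet.omega ∧ z = ZFSet.pair x y) ∧
      ∀ z ∈ v (), (∃ x y, x ⊆ ZFSet.omega ∧ y ⊆ ZFSet.omega ∧ z = ZFSet.pair x y) → z ∈ t)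
    ((DefinableIn.allMem hN _ ((DefinableIn.mem _ _).and
      (DefinableIn.isPairOfSubsets hN hω _))).and
      (DefinableIn.allMem hN _ ((DefinableIn.isPairOfSubsets hN hω _).imp (DefinableIn.mem _ _))))
    (fun _ => s) (fun _ => hs)
    ⟨_, hSet_of_subset (hM.subset hs) ZFSet.sep_subset, fun x hx => ZFSet.mem_sep.1 hx,
      fun x hx hx' => ZFSet.mem_sep.2 ⟨hx, hx'⟩⟩
  convert htM using 1
  ext z
  rw [ZFSet.mem_sep]
  exact ⟨fun hz => ht2 z hz.1 hz.2, ht1 z⟩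

theorem IsElementarySubmodel.exists_value_mem (hM : IsElementarySubmodel M (hSet χ))
    {G E : ZFSet.{u}} (hG : G ∈ M) (hE : E ∈ M) (h : ∃ a ∈ hSet χ, ZFSet.pair E a ∈ G) :
    ∃ a ∈ M, ZFSet.pair E a ∈ G :=
  hM.exists_mem (α := Bool) (P := fun t v => ZFSet.pair (v true) t ∈ v false)
    (DefinableIn.pairMem hSet_trans _ _ _) (fun b => if b then E else G)
    (by rintro (_ | _) <;> simpa) h

/-- An elementary submodel contains a nonempty subset of `ω` that does not belong to the field of a
given countable relation in the submodel. -/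
theorem IsElementarySubmodel.exists_notMem_field (hM : IsElementarySubmodel M (hSet χ))
    (hω : ZFSet.omega ∈ hSet χ) {E : ZFSet.{u}} (hE : E ∈ M)
    (hEc : (E : Set ZFSet.{u}).Countable) :
    ∃ t ∈ M, t ⊆ ZFSet.omega ∧ t ≠ ∅ ∧
      ∀ c ∈ hSet χ, ZFSet.pair c t ∉ E ∧ ZFSet.pair t c ∉ E := by
  have hN := hSet_trans (χ := χ)
  have hex : ∃ a : Set ℕ, a ∉ insert ∅
      (natsOf '' {d | ∃ c, ZFSet.pair c d ∈ E ∨ ZFSet.pair d c ∈ E}) := by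
    by_contra! hall
    have hc : (Set.univ : Set (Set ℕ)).Countable :=
      (((countable_field hEc).image natsOf).insert ∅).mono fun a _ => hall a
    rw [← Cardinal.le_aleph0_iff_set_countable, Cardinal.mk_univ, Cardinal.mk_set_nat] at hc
    exact hc.not_gt Cardinal.aleph0_lt_continuum
  obtain ⟨a, ha⟩ := hex
  rw [Set.mem_insert_iff, not_or] at ha
  obtain ⟨t, htM, ht1, ⟨k, hk, -⟩, ht3⟩ := hM.exists_mem (α := Unit)
    (P := fun t v => t ⊆ ZFSet.omega ∧ (∃ k ∈ t, k = k) ∧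
      ∀ c ∈ hSet χ, ¬ ZFSet.pair c t ∈ v () ∧ ¬ ZFSet.pair t c ∈ v ())
    ((DefinableIn.subsetOmega hN hω _).and ((DefinableIn.exMem hN _ (DefinableIn.eq _ _)).and
      (DefinableIn.all ((DefinableIn.pairMem hN _ _ _).not.and (DefinableIn.pairMem hN _ _ _).not))))
    (fun _ => E) (fun _ => hE)
    (by
      refine ⟨subsetZF a, hSet_of_subset hω (subsetZF_subset a), subsetZF_subset a, ?_, ?_⟩
      · obtain ⟨n, hn⟩ := Set.nonempty_iff_ne_empty.2 ha.1
        exact ⟨natZF n, mem_subsetZF.2 ⟨n, hn, rfl⟩, rfl⟩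
      · intro c _
        rw [← not_or]
        exact fun h => ha.2 ⟨subsetZF a, ⟨c, h⟩, natsOf_subsetZF a⟩)
  refine ⟨t, htM, ht1, ?_, ht3⟩
  rintro rfl
  exact ZFSet.notMem_empty k hk

end Elementary

/-! ### The MAD family inside the model -/

theorem exists_madFamily_of_sigmaSuborder {χ : Cardinal.{u}} (hχ : χ.IsRegular)
    (hP : ZFSet.powerset ZFSet.omega.{u} ∈ hSet χ) {M : Set ZFSet.{u}}
    (hM : IsApproachableModel χ M)
    (hσ : SigmaSuborder (fun x y : ZFSet.{u} => x ⊆ y)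
      ((ZFSet.powerset ZFSet.omega.{u} : Set ZFSet.{u}) ∩ M)
      (ZFSet.powerset ZFSet.omega.{u} : Set ZFSet.{u})) :
    ∃ A : Set (Set ℕ), IsMADFamily A ∧ #A = ℵ₁ ∧ ∀ a ∈ A, subsetZF.{u} a ∈ M := by
  obtain ⟨hel, hcard, r, hwo, hr, hs⟩ := hM
  have hω := omega_mem_hSet hP
  have hMN := hel.subset
  obtain ⟨G, hGM, hG⟩ := hel.exists_isSelector hχ hP
  choose s hsM hs using hs
  let E : M → ZFSet.{u} := fun x => (s x).sep fun z =>
    ∃ x y, x ⊆ ZFSet.omega ∧ y ⊆ ZFSet.omega ∧ z = ZFSet.pair x y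
  have hEM : ∀ x, E x ∈ M := fun x => hel.sep_pairs_mem hω (hsM x)
  have hE : IsSegmentMap M r E := by
    intro x z
    rw [ZFSet.mem_sep, hs]
    constructor
    · rintro ⟨⟨y, w, -, h2, h3, rfl⟩, y', w', hy', hw', h⟩
      obtain ⟨rfl, rfl⟩ := ZFSet.pair_inj.1 h
      exact ⟨y, w, h3, h2, hy', hw', rfl⟩
    · rintro ⟨y, w, h1, h2, h3, h4, rfl⟩
      exact ⟨⟨y, w, trans_of r h1 h2, h2, h1, rfl⟩, y, w, h3, h4, rfl⟩
  -- The well-order ⊏ supplies the induction showing that every `E x` lies in the domain of G.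
  have hval : ∀ x, ∃ a ∈ hSet χ, ZFSet.pair (E x) a ∈ G := by
    intro x
    induction x using (IsWellFounded.wf : WellFounded r).induction with
    | _ x ih =>
      refine hG.exists_value _ (hMN (hEM x)) (hE.isCountableRel hr x) fun E' _ hE' => ?_
      obtain ⟨y, hy, rfl⟩ := hE.exists_of_isProperSegment hE'
      exact ih y hy
  choose a haM ha using fun x => hel.exists_value_mem hGM (hEM x) (hval x)
  have hEN : ∀ x, E x ∈ hSet χ := fun x => hMN (hEM x)
  have haN : ∀ x, a x ∈ hSet χ := fun x => hMN (haM x)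
  have hainf : ∀ x, (natsOf (a x)).Infinite := fun x => hG.infinite _ (hEN x) _ (haN x) (ha x)
  have haω : ∀ x, a x ⊆ ZFSet.omega := fun x => hG.subset_omega _ (hEN x) _ (haN x) (ha x)
  -- Different x may code the same relation; the family is then indexed by the relations, and
  -- repetitions do no harm.
  have heq : ∀ x y, E x = E y → a x = a y := fun x y h =>
    hG.unique _ (hEN x) _ (haN x) _ (haN y) (ha x) (h ▸ ha y)
  have had_lt : ∀ x y, r y x → E x ≠ E y → (natsOf (a x) ∩ natsOf (a y)).Finite := by
    intro x y hyx hne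
    exact hG.finite_inter _ (hEN x) _ (haN x) (ha x) _ (hEN y)
      ((hE.eq_or_isProperSegment hMN hyx).resolve_left (Ne.symm hne)) _ (haN y) (ha y)
  have had : ∀ x y, E x ≠ E y → (natsOf (a x) ∩ natsOf (a y)).Finite := by
    intro x y hne
    rcases trichotomous_of r x y with h | h | h
    · rw [Set.inter_comm]
      exact had_lt y x h hne.symm
    · exact absurd (h ▸ rfl) hne
    · exact had_lt x y h hne
  have h0M : (∅ : ZFSet.{u}) ∈ M := hel.empty_mem hω
  -- A point enters the field of `E z` only when paired with a second one; ∅ serves as the partner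
  -- of every nonempty d.
  have hfield : ∀ (d z : M), (d : ZFSet.{u}) ⊆ ZFSet.omega → (d : ZFSet.{u}) ≠ ∅ → r d z →
      r ⟨∅, h0M⟩ z → ∃ c ∈ hSet χ, ZFSet.pair c d ∈ E z ∨ ZFSet.pair (d : ZFSet.{u}) c ∈ E z := by
    intro d z hd hd0 hdz h0z
    refine ⟨∅, hMN h0M, ?_⟩
    rcases trichotomous_of r ⟨∅, h0M⟩ d with h | h | h
    · exact Or.inl (hE.pair_mem_iff.2 ⟨h0M, d.2, h, hdz, ZFSet.empty_subset _, hd⟩)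
    · exact absurd (congrArg Subtype.val h).symm hd0
    · exact Or.inr (hE.pair_mem_iff.2 ⟨d.2, h0M, h, h0z, hd, ZFSet.empty_subset _⟩)
  -- If the range were countable, representatives of all values would lie below one x. A subset t of
  -- ω in M outside the field of `E x` gives a later z with `E z` ≠ `E x`; yet the value at z
  -- already occurs below x, and an infinite set is not almost disjoint from itself, so `E z` ⊆ `E
  -- x`.
  have hunc : ¬ (Set.range fun x => natsOf (a x)).Countable := by
    intro hc
    have : Nonempty M := ⟨⟨∅, h0M⟩⟩
    choose! f hf using fun b (hb : b ∈ Set.range fun x => natsOf (a x)) => hb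
    obtain ⟨x, hx⟩ := exists_forall_rel_of_countable hr (hc.image f)
    obtain ⟨t, htM, htω, ht0, ht⟩ := hel.exists_notMem_field hω (hEM x) (hE.isCountableRel hr x).1
    obtain ⟨z, hz⟩ := exists_forall_rel_of_countable hr
      (C := {x, ⟨∅, h0M⟩, ⟨t, htM⟩}) (Set.toFinite _).countable
    have hxz := hz x (by simp)
    have hne : E x ≠ E z := by
      intro h
      obtain ⟨c, hc, h1⟩ := hfield ⟨t, htM⟩ z htω ht0 (hz _ (by simp)) (hz _ (by simp))
      rw [← h] at h1
      exact h1.elim (ht c hc).1 (ht c hc).2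
    have hfz : natsOf (a (f (natsOf (a z)))) = natsOf (a z) := hf _ ⟨z, rfl⟩
    have hfx := hx _ (Set.mem_image_of_mem f (Set.mem_range_self (f := fun x => natsOf (a x)) z))
    have hEe : E (f (natsOf (a z))) = E z := by
      by_contra h
      have := had _ _ h
      rw [hfz, Set.inter_self] at this
      exact hainf z this
    refine hne (ZFSet.ext fun w => ⟨fun h => hE.subset hxz h, fun h => hE.subset hfx ?_⟩)
    rwa [hEe]
  have hmeet : ∀ X : Set ℕ, X.Infinite → ∃ x, (X ∩ natsOf (a x)).Infinite := by
    intro X hX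
    by_contra! hXa
    have hXP : ∀ n, subsetZF (X \ Set.Iic n) ∈
        (ZFSet.powerset ZFSet.omega.{u} : Set ZFSet.{u}) := fun n =>
      ZFSet.mem_powerset.2 (subsetZF_subset _)
    -- Coinitial families are fixed for all n at once, because the n that bounds X ∩ `a x` is known
    -- only after x has been chosen above all of them.
    choose C hCc hCsub hC using fun n => (hσ.2 _ (hXP n)).2
    have hC' : ((Subtype.val : M → ZFSet.{u}) ⁻¹' ⋃ n, C n).Countable :=
      (Set.countable_iUnion hCc).preimage Subtype.val_injective
    obtain ⟨x, hx⟩ := exists_forall_rel_of_countable hr (hC'.insert ⟨∅, h0M⟩)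
    obtain ⟨n, hn⟩ := (hXa x).bddAbove
    have hco : subsetZF (X \ Set.Iic n) ⊆ ZFSet.omega \ a x := by
      intro z hz
      refine ZFSet.mem_sdiff.2 ⟨subsetZF_subset _ hz, fun hza => ?_⟩
      obtain ⟨m, hm, rfl⟩ := mem_subsetZF.1 hz
      exact hm.2 (hn ⟨hm.1, hza⟩)
    obtain ⟨d, hdC, hd⟩ := hC n (ZFSet.omega \ a x)
      ⟨ZFSet.mem_powerset.2 fun z hz => (ZFSet.mem_sdiff.1 hz).1, hel.omega_sdiff_mem hω (haM x)⟩ hco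
    obtain ⟨⟨hdP, hdM⟩, hXd⟩ := hCsub n hdC
    have hXn : (X \ Set.Iic n).Infinite := hX.sdiff (Set.finite_Iic n)
    have hd0 : d ≠ ∅ := by
      rintro rfl
      obtain ⟨m, hm⟩ := hXn.nonempty
      exact ZFSet.notMem_empty _ (hXd (mem_subsetZF.2 ⟨m, hm, rfl⟩))
    -- The set X \ [0,n] need not lie in M: the selector property quantifies over H_χ, which
    -- contains every subset of ω.
    refine hG.not_finite_inter _ (hEN x) _ (haN x) (ha x) d (hMN hdM)
      (hfield ⟨d, hdM⟩ x (ZFSet.mem_powerset.1 hdP) hd0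
        (hx _ (Or.inr (Set.mem_iUnion.2 ⟨n, hdC⟩))) (hx _ (Or.inl rfl)))
      _ (hSet_of_subset hω (subsetZF_subset (X \ Set.Iic n))) hXd ?_ ?_ ?_
    · rwa [natsOf_subsetZF]
    · intro E' _ hE' a' ha'N ha'
      obtain ⟨y, -, rfl⟩ := hE.exists_of_isProperSegment hE'
      rw [hG.unique _ (hEN y) _ ha'N _ (haN y) ha' (ha y), natsOf_subsetZF]
      exact (hXa y).subset (Set.inter_subset_inter_left _ Set.sdiff_subset)
    · refine Set.finite_empty.subset fun m hm => ?_
      exact (ZFSet.mem_sdiff.1 (hd hm.2)).2 hm.1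
  refine ⟨Set.range fun x => natsOf (a x), ⟨⟨fun h => hunc h.countable, ?_, ?_⟩, ?_⟩, ?_, ?_⟩
  · rintro _ ⟨x, rfl⟩
    exact hainf x
  · rintro _ ⟨x, rfl⟩ _ ⟨y, rfl⟩ hne
    exact had x y fun h => hne (congrArg natsOf (heq x y h))
  · intro B hB hAB X hXB
    by_contra hXA
    obtain ⟨x, hx⟩ := hmeet X (hB.2.1 X hXB)
    exact hx (hB.2.2 hXB (hAB ⟨x, rfl⟩) fun h => hXA ⟨x, h.symm⟩)
  -- The upper bound holds because the family is indexed by M, of size ℵ₁.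
  · refine le_antisymm ?_ (not_lt.1 fun h => hunc ((countable_iff_mk_lt_aleph_one _).2 h))
    have h1 := Cardinal.mk_range_le_lift (f := fun x : M => natsOf (a x))
    rw [hcard] at h1
    simpa using h1
  · rintro _ ⟨x, rfl⟩
    rw [subsetZF_natsOf (haω x)]
    exact haM x

theorem almostDisjointnessNumber_eq_aleph_one {A : Set (Set ℕ)} (hA : IsMADFamily A)
    (hc : #A = ℵ₁) : almostDisjointnessNumber = ℵ₁ := by
  refine le_antisymm (csInf_le' ⟨A, hA, hc⟩) (le_csInf ⟨_, A, hA, hc⟩ ?_)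
  rintro _ ⟨B, hB, rfl⟩
  exact not_lt.1 fun h => hB.not_countable ((countable_iff_mk_lt_aleph_one _).2 h)

end SepVariant

theorem theorem8p12 :
    (SepVariant.SEPpm.{u} (ZFSet.powerset ZFSet.omega) (fun x y => x ⊆ y) →
      SepVariant.almostDisjointnessNumber = ℵ₁) ∧
    (∀ χ : Cardinal.{u}, χ.IsRegular →
      ZFSet.powerset ZFSet.omega.{u} ∈ SepVariant.hSet χ →
      ∀ M : Set ZFSet.{u}, SepVariant.IsApproachableModel χ M →
        SepVariant.SigmaSuborder (fun x y : ZFSet.{u} => x ⊆ y)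
          ((ZFSet.powerset ZFSet.omega.{u} : Set ZFSet.{u}) ∩ M)
          (ZFSet.powerset ZFSet.omega.{u} : Set ZFSet.{u}) →
        ∃ A : Set (Set ℕ), SepVariant.IsMADFamily A ∧ #A = ℵ₁ ∧
          ∀ a ∈ A, SepVariant.subsetZF.{u} a ∈ M) := by
  refine ⟨?_, fun χ hχ hP M hM hσ => SepVariant.exists_madFamily_of_sigmaSuborder hχ hP hM hσ⟩
  rintro ⟨χ, hχ, hP, M, hM, hσ⟩
  obtain ⟨A, hA, hc, -⟩ := SepVariant.exists_madFamily_of_sigmaSuborder hχ hP hM hσ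
  exact SepVariant.almostDisjointnessNumber_eq_aleph_one hA hc
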